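/- Let $n\ge 0$, let $\mathcal W=\mathfrak S_{n+1}$ with simple transpositions $s_i=(i,i+1)$, $1\le i\le n$, and let $\ell_{\mathcal S}$ and $\ell_{\mathcal T}$ be the length functions with respect to the simple transpositions and to all transpositions. Let $c=s_1s_2\cdots s_n$ and let $\mathcal P_c=\{x : \ell_{\mathcal T}(x)+\ell_{\mathcal T}(x^{-1}c)=\ell_{\mathcal T}(c)\}$ be the set of noncrossing partitions. Let $\mathrm{TL}_n$ be the unital associative $\mathbb Z[v,v^{-1}]$-algebra generated by $b_1,\dots,b_n$ with relations $b_jb_ib_j=b_j$ if $|i-j|=1$, $b_ib_j=b_jb_i$ if $|i-j|>1$, and $b_i^2=(v+v^{-1})b_i$; write $b_{s_i}=b_i$. Let $\omega$ be the algebra homomorphism from the group algebra over $\mathbb Z[v,v^{-1}]$ of the braid group on $n+1$ strands (with Artin generators $\mathbf s_1,\dots,\mathbf s_n$) to $\mathrm{TL}_n$ with $\omega(\mathbf s_i)=v^{-1}-b_i$. A transposition $(a,b)$, $a<b$, is lifted to the braid $\mathbf s_{a,b}=\mathbf s_{b-1}^{-1}\cdots\mathbf s_{a+1}^{-1}\mathbf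 s_a\mathbf s_{a+1}\cdots\mathbf s_{b-1}$; for $x\in\mathcal P_c$ let $Z_x$ be the image under $\omega$ of the product of the lifts of the letters of a reduced expression of $x$ as a product of transpositions (this does not depend on the expression). Let $w\in\mathcal W$ be fully commutative, i.e. any two reduced expressions of $w$ in the $s_i$ are related by commutations $st=ts$. It has a unique reduced expression $(s_{i_1}s_{i_1-1}\cdots s_{j_1})\cdots(s_{i_\ell}s_{i_\ell-1}\cdots s_{j_\ell})$ with $i_1<\dots<i_\ell$, $j_1<\dots<j_\ell$ and $j_m\le i_m$ for all $m$; put $I_w=\{i_1,\dots,i_\ell\}$, $J_w=\{j_1,\dots,j_\ell\}$. Let $\psi(w)$ be the unique $x\in\mathcal P_c$ for which the non-fixed points of $x$ that are not the maximum of their cycle form $J_w$, and those that are not the minimum of their cycle form $\{i+1 : i\in I_w\}$. Let $L(w)=\{s_i : \ell_{\mathcal S}(s_iw)<\ell_{\mathcal S}(w)\}$ and $R(w)=\{s_i : \ell_{\mathcal S}(ws_i)<\ell_{\mathcal S}(w)\}$. For $L\subseteq L(w)$ and $R\subseteq R(w)$, repeat the following as long as possible: if $s\in L\cap R$, remove $s$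 from $L$ or from $R$; if $s_j\in L$ and $s_{j-1}\in R$, remove $s_j$ from $L$ or $s_{j-1}$ from $R$. If $(L',R')$ is a pair so obtained, put $x_{L,R}=\bigl(\prod_{s\in L'}s\bigr)\psi(w)\bigl(\prod_{s\in R'}s\bigr)$ (this does not depend on the choices). Let $Q_w=\{x_{L,R} : L\subseteq L(w),\ R\subseteq R(w)\}$ and $$X_w=\sum_{x\in Q_w}(-1)^{\ell_{\mathcal S}(w)+\ell_{\mathcal S}(\psi(w))-\ell_{\mathcal S}(x)}\,v^{\ell_{\mathcal T}(x)-\ell_{\mathcal T}(\psi(w))}\,Z_x\in\mathrm{TL}_n .$$ Then, for every fully commutative $w$: 1. if $s\in L(w)$, then $b_sX_w=(v+v^{-1})X_w$; 2. if $s\in R(w)$, then $X_wb_s=(v+v^{-1})X_w$. -/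

import Mathlib

namespace ZinnoTL

noncomputable section

/- ### The symmetric group as a Coxeter group of type A

The symmetric group on `n + 1` points is `Equiv.Perm (Fin (n + 1))`. Indices are shifted by one:
the simple generators are indexed by `Fin n`, and `i : Fin n` stands for the transposition of
the points `i` and `i + 1`. -/

/-- The simple transposition `(i, i + 1)`. -/
def simpleRefl {n : ℕ} (i : Fin n) : Equiv.Perm (Fin (n + 1)) :=
  Equiv.swap i.castSucc i.succ

/-- The permutation represented by a word in the simple transpositions. -/
def wordProd {n : ℕ} (l : List (Fin n)) : Equiv.Perm (Fin (n + 1)) :=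
  (l.map simpleRefl).prod

/-- The length function of a group with respect to a set of generators. -/
def genLength {G : Type*} [Group G] (S : Set G) (g : G) : ℕ :=
  sInf {k | ∃ l : List G, (∀ x ∈ l, x ∈ S) ∧ l.prod = g ∧ l.length = k}

/-- The Coxeter length. -/
def lenS {n : ℕ} (w : Equiv.Perm (Fin (n + 1))) : ℕ :=
  genLength (Set.range (simpleRefl (n := n))) w

/-- The transposition length. -/
def lenT {n : ℕ} (w : Equiv.Perm (Fin (n + 1))) : ℕ :=
  genLength {t : Equiv.Perm (Fin (n + 1)) | t.IsSwap} w

/-- `l` is a reduced expression of `w` in the simple transpositions. -/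
def IsReducedWord {n : ℕ} (l : List (Fin n)) (w : Equiv.Perm (Fin (n + 1))) : Prop :=
  wordProd l = w ∧ l.length = lenS w

/-- One application of a relation `st = ts` inside a word. -/
inductive CommMove {n : ℕ} : List (Fin n) → List (Fin n) → Prop
  | swap (u v : List (Fin n)) (i j : Fin n)
      (h : simpleRefl i * simpleRefl j = simpleRefl j * simpleRefl i) :
      CommMove (u ++ i :: j :: v) (u ++ j :: i :: v)

/-- Any two reduced expressions are related by commutation relations. -/
def IsFullyCommutative {n : ℕ} (w : Equiv.Perm (Fin (n + 1))) : Prop :=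
  ∀ l l' : List (Fin n), IsReducedWord l w → IsReducedWord l' w →
    Relation.ReflTransGen CommMove l l'

/-- The left descent set `L(w)`. -/
def leftDescents {n : ℕ} (w : Equiv.Perm (Fin (n + 1))) : Finset (Fin n) :=
  Finset.univ.filter fun i => lenS (simpleRefl i * w) < lenS w

/-- The right descent set `R(w)`. -/
def rightDescents {n : ℕ} (w : Equiv.Perm (Fin (n + 1))) : Finset (Fin n) :=
  Finset.univ.filter fun i => lenS (w * simpleRefl i) < lenS w

/-- The word `s_i s_{i-1} ⋯ s_j`. -/
def descRun {n : ℕ} (i j : Fin n) : List (Fin n) :=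
  ((List.finRange n).filter fun k => j ≤ k ∧ k ≤ i).reverse

/-- `l = [(i₁, j₁), …, (i_ℓ, j_ℓ)]` with `i₁ < ⋯ < i_ℓ`, `j₁ < ⋯ < j_ℓ`, `j_m ≤ i_m`, such that
`(s_{i₁} ⋯ s_{j₁}) ⋯ (s_{i_ℓ} ⋯ s_{j_ℓ})` is a reduced expression of `w`. -/
def IsCanonicalForm {n : ℕ} (l : List (Fin n × Fin n)) (w : Equiv.Perm (Fin (n + 1))) : Prop :=
  l.Pairwise (fun p q => p.1 < q.1 ∧ p.2 < q.2) ∧ (∀ p ∈ l, p.2 ≤ p.1) ∧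
    IsReducedWord (l.flatMap fun p => descRun p.1 p.2) w

/-- The set `I_w` of the indices `i_m` of the canonical form of `w`. -/
def setI {n : ℕ} (w : Equiv.Perm (Fin (n + 1))) : Set (Fin n) :=
  {i | ∃ l, IsCanonicalForm l w ∧ ∃ p ∈ l, p.1 = i}

/-- The set `J_w` of the indices `j_m` of the canonical form of `w`. -/
def setJ {n : ℕ} (w : Equiv.Perm (Fin (n + 1))) : Set (Fin n) :=
  {j | ∃ l, IsCanonicalForm l w ∧ ∃ p ∈ l, p.2 = j}

/- ### Noncrossing partitions -/

/-- The Coxeter element `c = s_1 s_2 ⋯ s_n`. -/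
def coxeterElt (n : ℕ) : Equiv.Perm (Fin (n + 1)) :=
  wordProd (List.finRange n)

/-- The set `P_c` of noncrossing partitions, seen as permutations below `c` in the absolute
order. -/
def noncrossing (n : ℕ) : Set (Equiv.Perm (Fin (n + 1))) :=
  {x | lenT x + lenT (x⁻¹ * coxeterElt n) = lenT (coxeterElt n)}

/-- The set `D_x` of vertices of the polygons (nontrivial cycles) of `x` that are not the largest
vertex of their polygon. -/
def setD {n : ℕ} (x : Equiv.Perm (Fin (n + 1))) : Set (Fin (n + 1)) :=
  {m | x m ≠ m ∧ ¬ ∀ k, x.SameCycle m k → k ≤ m}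

/-- The set `U_x` of vertices of the polygons (nontrivial cycles) of `x` that are not the smallest
vertex of their polygon. -/
def setU {n : ℕ} (x : Equiv.Perm (Fin (n + 1))) : Set (Fin (n + 1)) :=
  {m | x m ≠ m ∧ ¬ ∀ k, x.SameCycle m k → m ≤ k}

open Classical in
/-- The noncrossing partition `ψ(w)` attached to a fully commutative `w`: the one with
`D = J_w` and `U = I_w + 1`. (For `w` not fully commutative the value is irrelevant.) -/
def psi {n : ℕ} (w : Equiv.Perm (Fin (n + 1))) : Equiv.Perm (Fin (n + 1)) :=
  if h : ∃ x ∈ noncrossing n, setD x = Fin.castSucc '' setJ w ∧ setU x = Fin.succ '' setI w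
  then h.choose else 1

/- ### The braid group and lifts of noncrossing partitions -/

/-- The braid relations on generators indexed by `Fin n`. -/
inductive BraidRel (n : ℕ) : FreeGroup (Fin n) → Prop
  | braid (i j : Fin n) (h : (i : ℕ) + 1 = j) :
      BraidRel n (FreeGroup.of i * FreeGroup.of j * FreeGroup.of i *
        (FreeGroup.of j * FreeGroup.of i * FreeGroup.of j)⁻¹)
  | comm (i j : Fin n) (h : (i : ℕ) + 1 < j ∨ (j : ℕ) + 1 < i) :
      BraidRel n (FreeGroup.of i * FreeGroup.of j * (FreeGroup.of j * FreeGroup.of i)⁻¹)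

/-- The braid group on `n + 1` strands. -/
abbrev BraidGroup (n : ℕ) : Type :=
  PresentedGroup {r | BraidRel n r}

/-- The Artin generator indexed by `i`. -/
def braidGen {n : ℕ} (i : Fin n) : BraidGroup n :=
  PresentedGroup.of i

/-- A transposition `(a, b)` of the points, recorded by the pair `a < b`. -/
abbrev Transp (n : ℕ) : Type :=
  {p : Fin (n + 1) × Fin (n + 1) // p.1 < p.2}

/-- The permutation recorded by `t`. -/
def Transp.toPerm {n : ℕ} (t : Transp n) : Equiv.Perm (Fin (n + 1)) :=
  Equiv.swap t.1.1 t.1.2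

/-- For `t = (a, b)` with `a < b`, the braid
`s_{b-1}⁻¹ ⋯ s_{a+1}⁻¹ s_a s_{a+1} ⋯ s_{b-1}` lifting `t`. -/
def syllable {n : ℕ} (t : Transp n) : BraidGroup n :=
  let a : Fin n := ⟨t.1.1, by have := t.2; have := t.1.2.2; omega⟩
  let u : BraidGroup n :=
    (((List.finRange n).filter fun k => a < k ∧ k.castSucc < t.1.2).map braidGen).prod
  u⁻¹ * braidGen a * u

/-- `l` is a reduced expression of `x` in the transpositions. -/
def IsReducedTransp {n : ℕ} (l : List (Transp n)) (x : Equiv.Perm (Fin (n + 1))) : Prop :=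
  (l.map Transp.toPerm).prod = x ∧ l.length = lenT x

theorem exists_isReducedTransp {n : ℕ} (x : Equiv.Perm (Fin (n + 1))) :
    ∃ l : List (Transp n), IsReducedTransp l x := by
  have hne : {k | ∃ l : List (Equiv.Perm (Fin (n + 1))),
      (∀ y ∈ l, y ∈ {t : Equiv.Perm (Fin (n + 1)) | t.IsSwap}) ∧ l.prod = x ∧
        l.length = k}.Nonempty := by
    obtain ⟨l, h1, h2⟩ := (Equiv.Perm.truncSwapFactors x).out
    exact ⟨_, l, h2, h1, rfl⟩
  obtain ⟨l, h1, h2, h3⟩ := Nat.sInf_mem hne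
  have key : ∀ l : List (Equiv.Perm (Fin (n + 1))), (∀ y ∈ l, y.IsSwap) →
      ∃ l' : List (Transp n), l'.map Transp.toPerm = l := by
    intro l
    induction l with
    | nil => exact fun _ => ⟨[], rfl⟩
    | cons y l ih =>
      intro h
      obtain ⟨l', hl'⟩ := ih fun z hz => h z (List.mem_cons_of_mem _ hz)
      obtain ⟨a, b, hab, hy⟩ := h y List.mem_cons_self
      rcases lt_or_gt_of_ne hab with hlt | hlt
      · exact ⟨⟨(a, b), hlt⟩ :: l', by simp [hl', hy, Transp.toPerm]⟩
      · exact ⟨⟨(b, a), hlt⟩ :: l', by simp [hl', hy, Transp.toPerm, Equiv.swap_comm]⟩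
  obtain ⟨l', hl'⟩ := key l h1
  refine ⟨l', by rw [hl', h2], ?_⟩
  have : l'.length = l.length := by rw [← hl', List.length_map]
  rw [this, h3]
  rfl

/-- The lift to the braid group of a noncrossing partition `x` (a simple element of the dual braid
monoid): the product of the lifts of the letters of a reduced expression of `x` in the
transpositions. -/
def simpleElt {n : ℕ} (x : Equiv.Perm (Fin (n + 1))) : BraidGroup n :=
  ((exists_isReducedTransp x).choose.map syllable).prod

/- ### The Temperley-Lieb algebra -/

/-- The ring `ℤ[v, v⁻¹]`; the power `v ^ k` is `LaurentPolynomial.T k`. -/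
abbrev Scalars : Type := LaurentPolynomial ℤ

/-- The power `v ^ k`. -/
abbrev vPow (k : ℤ) : Scalars := LaurentPolynomial.T k

/-- The defining relations of the Temperley-Lieb algebra. -/
inductive TLRel (n : ℕ) : FreeAlgebra Scalars (Fin n) → FreeAlgebra Scalars (Fin n) → Prop
  | adj (i j : Fin n) (h : (i : ℕ) + 1 = j ∨ (j : ℕ) + 1 = i) :
      TLRel n (FreeAlgebra.ι Scalars j * FreeAlgebra.ι Scalars i * FreeAlgebra.ι Scalars j)
        (FreeAlgebra.ι Scalars j)
  | comm (i j : Fin n) (h : (i : ℕ) + 1 < j ∨ (j : ℕ) + 1 < i) :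
      TLRel n (FreeAlgebra.ι Scalars i * FreeAlgebra.ι Scalars j)
        (FreeAlgebra.ι Scalars j * FreeAlgebra.ι Scalars i)
  | sq (i : Fin n) :
      TLRel n (FreeAlgebra.ι Scalars i * FreeAlgebra.ι Scalars i)
        ((vPow 1 + vPow (-1)) • FreeAlgebra.ι Scalars i)

/-- The Temperley-Lieb algebra with `n` generators. -/
def TL (n : ℕ) : Type := RingQuot (TLRel n)

instance (n : ℕ) : Ring (TL n) := inferInstanceAs (Ring (RingQuot (TLRel n)))

instance (n : ℕ) : Algebra Scalars (TL n) :=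
  inferInstanceAs (Algebra Scalars (RingQuot (TLRel n)))

/-- The quotient map from the free algebra. -/
def tlMk (n : ℕ) : FreeAlgebra Scalars (Fin n) →ₐ[Scalars] TL n :=
  RingQuot.mkAlgHom Scalars (TLRel n)

theorem tlMk_rel {n : ℕ} {x y : FreeAlgebra Scalars (Fin n)} (h : TLRel n x y) :
    tlMk n x = tlMk n y :=
  RingQuot.mkAlgHom_rel Scalars h

/-- The generator `b_i`. -/
def tlGen {n : ℕ} (i : Fin n) : TL n :=
  tlMk n (FreeAlgebra.ι Scalars i)

theorem tlGen_adj {n : ℕ} (i j : Fin n) (h : (i : ℕ) + 1 = j ∨ (j : ℕ) + 1 = i) :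
    tlGen j * tlGen i * tlGen j = tlGen j := by
  simpa [tlGen] using tlMk_rel (TLRel.adj i j h)

theorem tlGen_comm {n : ℕ} (i j : Fin n) (h : (i : ℕ) + 1 < j ∨ (j : ℕ) + 1 < i) :
    tlGen i * tlGen j = tlGen j * tlGen i := by
  simpa [tlGen] using tlMk_rel (TLRel.comm i j h)

theorem tlGen_sq {n : ℕ} (i : Fin n) :
    tlGen i * tlGen i = (vPow 1 + vPow (-1)) • tlGen i := by
  have := tlMk_rel (TLRel.sq i)
  rwa [map_mul, map_smul] at this

theorem vPow_mul_neg : vPow 1 * vPow (-1) = 1 := by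
  rw [← LaurentPolynomial.T_add]; simp

theorem unit_aux {R A : Type*} [CommRing R] [Ring A] [Algebra R A] (p q : R) (h : p * q = 1)
    (a : A) (ha : a * a = (p + q) • a) :
    (p • (1 : A) - a) * (q • (1 : A) - a) = 1 := by
  simp only [sub_mul, mul_sub, smul_mul_assoc, mul_smul_comm, one_mul, mul_one, ha, smul_sub,
    smul_smul, h, mul_comm q p, one_smul, add_smul]
  abel

theorem braid_aux {R A : Type*} [CommRing R] [Ring A] [Algebra R A] (p q : R) (h : p * q = 1)
    (a b : A) (ha : a * a = (q + p) • a) (haba : a * b * a = a) :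
    (p • (1 : A) - a) * (p • (1 : A) - b) * (p • (1 : A) - a) =
      (p * (p * p)) • (1 : A) - (p * p) • (a + b) + p • (a * b + b * a) := by
  have e : (p • (1 : A) - a) * (p • (1 : A) - b) * (p • (1 : A) - a) =
      (p * (p * p)) • (1 : A) - (p * p) • (a + b) + p • (a * b + b * a) - (p * p) • a +
        p • (a * a) - a * b * a := by
    simp only [sub_mul, mul_sub, smul_mul_assoc, mul_smul_comm, one_mul, mul_one, smul_smul,
      smul_add, smul_sub]
    abel
  rw [e, ha, haba, smul_smul, mul_add, h, add_smul, one_smul]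
  abel

/-- The invertible element `v⁻¹ - b_i`, with inverse `v - b_i`. -/
def braidImage {n : ℕ} (i : Fin n) : (TL n)ˣ where
  val := vPow (-1) • (1 : TL n) - tlGen i
  inv := vPow 1 • (1 : TL n) - tlGen i
  val_inv := unit_aux (A := TL n) _ _ (by rw [mul_comm, vPow_mul_neg]) _
    (by rw [add_comm, tlGen_sq])
  inv_val := unit_aux (A := TL n) _ _ vPow_mul_neg _ (tlGen_sq i)

theorem braidImage_rel {n : ℕ} (r : FreeGroup (Fin n)) (hr : r ∈ {r | BraidRel n r}) :
    FreeGroup.lift braidImage r = 1 := by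
  rcases hr with ⟨i, j, h⟩ | ⟨i, j, h⟩
  · rw [map_mul, map_inv, mul_inv_eq_one]
    ext
    simp only [map_mul, FreeGroup.lift_apply_of, Units.val_mul, braidImage]
    have hv : vPow (-1) * vPow 1 = 1 := by rw [mul_comm, vPow_mul_neg]
    rw [braid_aux (A := TL n) _ _ hv _ _ (tlGen_sq i) (tlGen_adj j i (Or.inr h)),
      braid_aux (A := TL n) _ _ hv _ _ (tlGen_sq j) (tlGen_adj i j (Or.inl h)),
      add_comm (tlGen i), add_comm (tlGen i * tlGen j)]
  · rw [map_mul, map_inv, mul_inv_eq_one]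
    ext
    simp only [map_mul, FreeGroup.lift_apply_of, Units.val_mul, braidImage]
    generalize vPow (-1) = p
    simp only [sub_mul, mul_sub, smul_mul_assoc, mul_smul_comm, one_mul, mul_one, smul_sub,
      tlGen_comm i j h]
    abel

/-- The quotient map `ω` from the group algebra of the braid group to the Temperley-Lieb algebra
sending the Artin generator with index `i` to `v⁻¹ - b_i`. -/
def omega (n : ℕ) : MonoidAlgebra Scalars (BraidGroup n) →ₐ[Scalars] TL n :=
  MonoidAlgebra.lift Scalars (TL n) (BraidGroup n)
    ((Units.coeHom (TL n)).comp (PresentedGroup.toGroup braidImage_rel))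

/-- The element `Z_x` of the Zinno basis. -/
def zinno {n : ℕ} (x : Equiv.Perm (Fin (n + 1))) : TL n :=
  omega n (MonoidAlgebra.of Scalars (BraidGroup n) (simpleElt x))

/- ### The elements `X_w` -/

/-- One step of the reduction of a pair `(L, R)`: if `s` lies in both `L` and `R`, remove it from
one of them; if `s_{k+1} ∈ L` and `s_k ∈ R`, remove one of these two. -/
inductive PairStep {n : ℕ} :
    Finset (Fin n) × Finset (Fin n) → Finset (Fin n) × Finset (Fin n) → Prop
  | bothLeft (L R : Finset (Fin n)) (i : Fin n) (hL : i ∈ L) (hR : i ∈ R) :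
      PairStep (L, R) (L.erase i, R)
  | bothRight (L R : Finset (Fin n)) (i : Fin n) (hL : i ∈ L) (hR : i ∈ R) :
      PairStep (L, R) (L, R.erase i)
  | adjLeft (L R : Finset (Fin n)) (j k : Fin n) (h : (k : ℕ) + 1 = j) (hL : j ∈ L)
      (hR : k ∈ R) : PairStep (L, R) (L.erase j, R)
  | adjRight (L R : Finset (Fin n)) (j k : Fin n) (h : (k : ℕ) + 1 = j) (hL : j ∈ L)
      (hR : k ∈ R) : PairStep (L, R) (L, R.erase k)

/-- `p` can be reached from `q` by the reduction process and admits no further step. -/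
def IsEndingPair {n : ℕ} (q p : Finset (Fin n) × Finset (Fin n)) : Prop :=
  Relation.ReflTransGen PairStep q p ∧ ∀ p', ¬ PairStep p p'

/-- The product of the simple transpositions in `A`, in increasing order of the indices (they
commute with each other when `A` is contained in a descent set of a fully commutative element). -/
def setProd {n : ℕ} (A : Finset (Fin n)) : Equiv.Perm (Fin (n + 1)) :=
  wordProd (A.sort (· ≤ ·))

/-- The set `Q_w` of all `x_{L,R} = (∏_{s ∈ L'} s) ψ(w) (∏_{s ∈ R'} s)`, where `L ⊆ L(w)`,
`R ⊆ R(w)` and `(L', R')` is an ending pair for `(L, R)`. -/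
def setQ {n : ℕ} (w : Equiv.Perm (Fin (n + 1))) : Set (Equiv.Perm (Fin (n + 1))) :=
  {x | ∃ L ⊆ leftDescents w, ∃ R ⊆ rightDescents w, ∃ L' R' : Finset (Fin n),
    IsEndingPair (L, R) (L', R') ∧ x = setProd L' * psi w * setProd R'}

/-- The exponent `α_w(x)`. -/
def alphaExp {n : ℕ} (w x : Equiv.Perm (Fin (n + 1))) : ℤ :=
  (lenS w : ℤ) + lenS (psi w) - lenS x

/-- The exponent `β_w(x)`. -/
def betaExp {n : ℕ} (w x : Equiv.Perm (Fin (n + 1))) : ℤ :=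
  (lenT x : ℤ) - lenT (psi w)

/-- The coefficient `p_x^w = (-1)^{α_w(x)} v^{β_w(x)}`. -/
def coeffP {n : ℕ} (w x : Equiv.Perm (Fin (n + 1))) : Scalars :=
  (((-1 : ℤˣ) ^ alphaExp w x : ℤˣ) : ℤ) • vPow (betaExp w x)

open Classical in
/-- The element `X_w = ∑_{x ∈ Q_w} p_x^w Z_x`. -/
def basisX {n : ℕ} (w : Equiv.Perm (Fin (n + 1))) : TL n :=
  ∑ x ∈ Finset.univ.filter (fun x => x ∈ setQ w), coeffP w x • zinno x

end

end ZinnoTL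

namespace ZinnoTL

open Equiv

/- ### Length functions of permutation groups -/

section GenLength

variable {G : Type*} [Group G] {S : Set G}

/-! The mechanism is a pairing. Let `s ∈ L(w)`. Left multiplication by `s` is an involution of
`Q_w`, and it changes the transposition length by exactly one. Take `x` with `sx` the longer of the
two. A reduced expression of `x` preceded by `s` is a reduced expression of `sx`, so `Z_{sx} = (v⁻¹
- b_s) Z_x`. The coefficients satisfy `p_{sx} = -v p_x`, because the sign changes and the exponent
of `v` grows by one. Hence `p_x Z_x + p_{sx} Z_{sx} = v p_x b_s Z_x`, so `X_w` is a sum of left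
multiples of `b_s`, and `b_s² = (v + v⁻¹) b_s` finishes. The right side is symmetric.

Two facts have to be supplied. The first is that `Z_x` may be computed from any reduced expression.
Being below `c` is translated into the arc condition `IsNC` (`mem_noncrossing_iff`). In
`ncLift_mul_swap` any transposition that splits a cycle of `x` is then moved to the right end of a
normal form, by means of the relations between band generators of the braid group.

The second is that `Q_w` consists of noncrossing permutations and is stable under the two
multiplications. A fully commutative `w` avoids 321, and its canonical form identifies `J_w` and
`I_w + 1` with its excedance positions and values, so `ψ(w)` has the same excedances as `w`
(`IsFullyCommutative.psi_spec`). The descents of `w` therefore control `ψ(w)` near the points they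
move, which is enough for every twist to remain noncrossing (`IsTwistable`). Whenever a pair of
letters is in conflict, `s ψ(w) t = ψ(w)`. The reduction of `(L, R)` then does not restrict
anything: `Q_w` is the set of all products `(∏ A) ψ(w) (∏ B)` with `A ⊆ L(w)`, `B ⊆ R(w)`
(`IsFullyCommutative.mem_setQ`), and its stability is clear. -/

theorem genLength_le {l : List G} (hl : ∀ x ∈ l, x ∈ S) : genLength S l.prod ≤ l.length :=
  Nat.sInf_le ⟨l, hl, rfl, rfl⟩

/-- Generation as a monoid makes the set of word lengths nonempty, so the infimum is attained and is
not the default value `0` of `sInf ∅`. -/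
theorem exists_word_genLength (hS : Submonoid.closure S = ⊤) (g : G) :
    ∃ l : List G, (∀ x ∈ l, x ∈ S) ∧ l.prod = g ∧ l.length = genLength S g := by
  have hne : {k | ∃ l : List G, (∀ x ∈ l, x ∈ S) ∧ l.prod = g ∧ l.length = k}.Nonempty := by
    obtain ⟨l, h1, h2⟩ :=
      Submonoid.exists_list_of_mem_closure (hS ▸ Submonoid.mem_top g : g ∈ Submonoid.closure S)
    exact ⟨_, l, h1, h2, rfl⟩
  exact Nat.sInf_mem hne

theorem genLength_one : genLength S (1 : G) = 0 :=
  Nat.le_zero.1 (genLength_le (l := []) (by simp))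

theorem genLength_mul_le (hS : Submonoid.closure S = ⊤) (g h : G) :
    genLength S (g * h) ≤ genLength S g + genLength S h := by
  obtain ⟨l, h1, h2, h3⟩ := exists_word_genLength hS g
  obtain ⟨l', h1', h2', h3'⟩ := exists_word_genLength hS h
  rw [← h3, ← h3', ← List.length_append, ← h2, ← h2', ← List.prod_append]
  refine genLength_le fun x hx => ?_
  rcases List.mem_append.1 hx with hx | hx
  exacts [h1 x hx, h1' x hx]

theorem genLength_mem_le {s : G} (hs : s ∈ S) : genLength S s ≤ 1 := by
  simpa using genLength_le (S := S) (l := [s]) (by simpa using hs)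

theorem eq_one_of_genLength_eq_zero (hS : Submonoid.closure S = ⊤) {g : G}
    (h : genLength S g = 0) : g = 1 := by
  obtain ⟨l, -, h2, h3⟩ := exists_word_genLength hS g
  rw [h, List.length_eq_zero_iff] at h3
  simpa [h3] using h2.symm

theorem exists_mul_genLength_lt (hS : Submonoid.closure S = ⊤) {g : G} (hg : g ≠ 1) :
    ∃ s ∈ S, ∃ h, g = s * h ∧ genLength S h + 1 = genLength S g := by
  obtain ⟨l, h1, h2, h3⟩ := exists_word_genLength hS g
  cases l with
  | nil => exact absurd h2.symm (by simpa using hg)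
  | cons s l =>
    refine ⟨s, h1 s (by simp), l.prod, by simpa using h2.symm, le_antisymm ?_ ?_⟩
    · rw [← h3, List.length_cons]
      exact Nat.succ_le_succ (genLength_le fun x hx => h1 x (List.mem_cons_of_mem _ hx))
    · have := genLength_mul_le hS s l.prod
      have h4 := genLength_mem_le (h1 s (by simp))
      rw [← List.prod_cons, h2] at this
      omega

theorem sign_eq_neg_one_pow_genLength {α : Type*} [Fintype α] [DecidableEq α] {S : Set (Perm α)}
    (hS : Submonoid.closure S = ⊤) (hsign : ∀ s ∈ S, Perm.sign s = -1) (g : Perm α) :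
    Perm.sign g = (-1) ^ genLength S g := by
  obtain ⟨l, h1, h2, h3⟩ := exists_word_genLength hS g
  rw [← h3, ← h2]
  clear h2 h3
  induction l with
  | nil => simp
  | cons s l ih =>
    rw [List.prod_cons, map_mul, ih fun x hx => h1 x (List.mem_cons_of_mem _ hx),
      hsign s (h1 s (by simp)), List.length_cons, pow_succ']

end GenLength

variable {n : ℕ}

theorem closure_simpleRefl : Submonoid.closure (Set.range (simpleRefl (n := n))) = ⊤ :=
  Perm.mclosure_swap_castSucc_succ n

theorem isSwap_simpleRefl (i : Fin n) : (simpleRefl i).IsSwap :=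
  ⟨_, _, i.castSucc_lt_succ.ne, rfl⟩

theorem sign_simpleRefl (i : Fin n) : Perm.sign (simpleRefl i) = -1 :=
  (isSwap_simpleRefl i).sign_eq

@[simp]
theorem simpleRefl_mul_self (i : Fin n) : simpleRefl i * simpleRefl i = 1 :=
  swap_mul_self _ _

theorem sign_eq_lenS (w : Perm (Fin (n + 1))) : Perm.sign w = (-1) ^ lenS w :=
  sign_eq_neg_one_pow_genLength closure_simpleRefl (by rintro _ ⟨i, rfl⟩; exact sign_simpleRefl i) w

theorem sign_eq_lenT (w : Perm (Fin (n + 1))) : Perm.sign w = (-1) ^ lenT w :=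
  sign_eq_neg_one_pow_genLength Perm.mclosure_isSwap (fun _ h => Perm.IsSwap.sign_eq h) w

theorem lenT_mul_le (x y : Perm (Fin (n + 1))) : lenT (x * y) ≤ lenT x + lenT y :=
  genLength_mul_le Perm.mclosure_isSwap x y

theorem lenT_isSwap_le {t : Perm (Fin (n + 1))} (ht : t.IsSwap) : lenT t ≤ 1 :=
  genLength_mem_le ht

/-- Parity: a transposition changes the sign, and the sign determines the length modulo two. -/
theorem lenT_mul_ne {x t : Perm (Fin (n + 1))} (ht : t.IsSwap) : lenT (x * t) ≠ lenT x := by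
  intro h
  have h1 := sign_eq_lenT (x * t)
  rw [map_mul, h, sign_eq_lenT x, ht.sign_eq, mul_neg_one] at h1
  exact neg_units_ne_self _ h1

theorem lenT_mul_swap {x t : Perm (Fin (n + 1))} (ht : t.IsSwap) :
    lenT (x * t) = lenT x + 1 ∨ lenT (x * t) + 1 = lenT x := by
  have h1 := lenT_mul_le x t
  have h2 := lenT_mul_le (x * t) t
  have h3 := lenT_isSwap_le ht
  have h4 := lenT_mul_ne (x := x) ht
  have h5 : t * t = 1 := by obtain ⟨a, b, -, rfl⟩ := ht; exact swap_mul_self _ _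
  rw [mul_assoc, h5, mul_one] at h2
  omega

/- ### The transposition length and the fixed space -/

/-- The functions invariant under a permutation. -/
def fixedFunctions {α : Type*} (x : Perm α) : Submodule ℚ (α → ℚ) where
  carrier := {f | ∀ i, f (x i) = f i}
  zero_mem' := fun _ => rfl
  add_mem' := fun hf hg i => by simp [hf i, hg i]
  smul_mem' := fun c f hf i => by simp [hf i]

theorem mem_fixedFunctions {α : Type*} {x : Perm α} {f : α → ℚ} :
    f ∈ fixedFunctions x ↔ ∀ i, f (x i) = f i := Iff.rfl

theorem apply_eq_of_sameCycle {α : Type*} {x : Perm α} {f : α → ℚ} (hf : f ∈ fixedFunctions x)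
    {a b : α} (h : x.SameCycle a b) : f a = f b := by
  obtain ⟨k, rfl⟩ := h
  induction k with
  | zero => simp
  | succ k ih => rw [add_comm, zpow_add, zpow_one, Perm.mul_apply, hf, ih]
  | pred k ih => rw [ih, ← hf ((x ^ (-(k : ℤ) - 1)) a), ← Perm.mul_apply, ← zpow_one_add, add_sub_cancel]

open Classical in
theorem indicator_mem_fixedFunctions {α : Type*} (x : Perm α) (a : α) :
    (fun i => if x.SameCycle a i then (1 : ℚ) else 0) ∈ fixedFunctions x := fun i => by
  simp only [Perm.sameCycle_apply_right]

/-- On the hyperplane `f a = f b` the transposition acts trivially, so the two permutations have the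
same invariants there. -/
theorem mem_fixedFunctions_mul_swap {α : Type*} [DecidableEq α] {x : Perm α} {f : α → ℚ} {a b : α}
    (hf : f a = f b) : f ∈ fixedFunctions (x * swap a b) ↔ f ∈ fixedFunctions x := by
  have key : ∀ i, f (swap a b i) = f i := fun i => by
    by_cases h1 : i = a
    · simp [h1, hf]
    · by_cases h2 : i = b
      · simp [h2, hf]
      · rw [swap_apply_of_ne_of_ne h1 h2]
  constructor
  · intro h i
    have := h (swap a b i)
    rwa [Perm.mul_apply, swap_apply_self, key] at this
  · intro h i
    rw [Perm.mul_apply, h, key]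

theorem finrank_le_of_inf_ker_le {V : Type*} [AddCommGroup V] [Module ℚ V]
    [FiniteDimensional ℚ V] (A B : Submodule ℚ V) (φ : V →ₗ[ℚ] ℚ)
    (h : ∀ v ∈ A, φ v = 0 → v ∈ B) : Module.finrank ℚ A ≤ Module.finrank ℚ B + 1 := by
  have h1 := (φ.domRestrict A).finrank_range_add_finrank_ker
  have h2 : Module.finrank ℚ (LinearMap.range (φ.domRestrict A)) ≤ 1 := by
    simpa using Submodule.finrank_le (LinearMap.range (φ.domRestrict A))
  have h3 : Module.finrank ℚ (LinearMap.ker (φ.domRestrict A)) ≤ Module.finrank ℚ B := by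
    refine LinearMap.finrank_le_finrank_of_injective
      (f := ((A.subtype.comp (LinearMap.ker (φ.domRestrict A)).subtype).codRestrict B
        fun v => h _ v.1.2 v.2)) fun u v huv => ?_
    have := congrArg Subtype.val huv
    exact Subtype.ext (Subtype.ext this)
  omega

/-- The number of cycles, fixed points included. -/
noncomputable def cycleCount (x : Perm (Fin (n + 1))) : ℕ :=
  Module.finrank ℚ (fixedFunctions x)

theorem cycleCount_one : cycleCount (1 : Perm (Fin (n + 1))) = n + 1 := by
  have : fixedFunctions (1 : Perm (Fin (n + 1))) = ⊤ := by
    ext f; simp [mem_fixedFunctions]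
  rw [cycleCount, this, finrank_top, Module.finrank_fin_fun]

theorem cycleCount_le_mul_swap (x : Perm (Fin (n + 1))) (a b : Fin (n + 1)) :
    cycleCount x ≤ cycleCount (x * swap a b) + 1 :=
  finrank_le_of_inf_ker_le _ _ (LinearMap.proj (R := ℚ) (φ := fun _ => ℚ) a - LinearMap.proj b)
    fun _ hv h => (mem_fixedFunctions_mul_swap (sub_eq_zero.1 h)).2 hv

theorem le_cycleCount_add_length (l : List (Perm (Fin (n + 1)))) (hl : ∀ t ∈ l, t.IsSwap) :
    n + 1 ≤ cycleCount l.prod + l.length := by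
  induction l using List.reverseRecOn with
  | nil => simp [cycleCount_one]
  | append_singleton l t ih =>
    have h1 := ih fun s hs => hl s (by simp [hs])
    obtain ⟨a, b, -, rfl⟩ := hl t (by simp)
    have h2 := cycleCount_le_mul_swap l.prod a b
    simp only [List.prod_append, List.prod_singleton, List.length_append, List.length_singleton]
    omega

theorem lenT_add_cycleCount_le (x : Perm (Fin (n + 1))) : lenT x + cycleCount x ≤ n + 1 := by
  have key : ∀ (k : ℕ) (x : Perm (Fin (n + 1))), n + 1 - cycleCount x = k →
      lenT x + cycleCount x ≤ n + 1 := by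
    intro k
    induction k using Nat.strong_induction_on with
    | _ k ih =>
      intro x hk
      by_cases hx : x = 1
      · simp [hx, cycleCount_one, lenT, genLength_one]
      obtain ⟨a, ha⟩ : ∃ a, x a ≠ a := by
        by_contra! h
        exact hx (Equiv.ext h)
      -- Multiplying by `swap a (x a)` cuts the point `x a` out of its cycle: the indicator of `x a`
      -- becomes invariant, which it was not before.
      have hlt : fixedFunctions x < fixedFunctions (x * swap a (x a)) := by
        refine lt_of_le_of_ne (fun f hf => (mem_fixedFunctions_mul_swap (hf a).symm).2 hf) ?_
        intro heq
        have hmem : Pi.single (x a) (1 : ℚ) ∈ fixedFunctions (x * swap a (x a)) := by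
          intro i
          have : (x * swap a (x a)) i = x a ↔ i = x a := by
            rw [Perm.mul_apply, x.apply_eq_iff_eq, swap_apply_eq_iff, swap_apply_left]
          by_cases hi : i = x a
          · rw [this.2 hi, hi]
          · rw [Pi.single_eq_of_ne (mt this.1 hi), Pi.single_eq_of_ne hi]
        rw [← heq] at hmem
        have := hmem a
        rw [Pi.single_eq_same, Pi.single_eq_of_ne (Ne.symm ha)] at this
        exact one_ne_zero this
      have h1 : cycleCount x < cycleCount (x * swap a (x a)) := Submodule.finrank_lt_finrank_of_lt hlt
      have h2 : cycleCount (x * swap a (x a)) ≤ n + 1 := by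
        simpa [cycleCount] using Submodule.finrank_le (fixedFunctions (x * swap a (x a)))
      have h3 := ih _ (by omega) (x * swap a (x a)) rfl
      have h4 := lenT_mul_swap (x := x) ⟨a, x a, ha.symm, rfl⟩
      omega
  exact key _ x rfl

theorem lenT_add_cycleCount (x : Perm (Fin (n + 1))) : lenT x + cycleCount x = n + 1 := by
  refine le_antisymm (lenT_add_cycleCount_le x) ?_
  obtain ⟨l, h1, h2, h3⟩ := exists_word_genLength Perm.mclosure_isSwap x
  have := le_cycleCount_add_length l h1
  rw [h2, h3] at this
  rw [lenT]
  omega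

/-- An invariant of `x` takes equal values at `a` and `b`, so it stays invariant. The cycle count
cannot drop, hence the length cannot rise. -/
theorem lenT_mul_swap_of_sameCycle {x : Perm (Fin (n + 1))} {a b : Fin (n + 1)} (hab : a ≠ b)
    (h : x.SameCycle a b) : lenT (x * swap a b) + 1 = lenT x := by
  have h1 : cycleCount x ≤ cycleCount (x * swap a b) :=
    Submodule.finrank_mono fun f hf =>
      (mem_fixedFunctions_mul_swap (apply_eq_of_sameCycle hf h)).2 hf
  have h2 := lenT_add_cycleCount x
  have h3 := lenT_add_cycleCount (x * swap a b)
  rcases lenT_mul_swap (x := x) ⟨a, b, hab, rfl⟩ with h4 | h4 <;> omega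

theorem finrank_inf_ker_of_not_sameCycle {x : Perm (Fin (n + 1))} {a b : Fin (n + 1)}
    (h : ¬ x.SameCycle a b) :
    Module.finrank ℚ (fixedFunctions x ⊓ LinearMap.ker
      (LinearMap.proj (R := ℚ) (φ := fun _ : Fin (n + 1) => ℚ) a - LinearMap.proj b) :
        Submodule ℚ (Fin (n + 1) → ℚ)) + 1 = cycleCount x := by
  classical
  refine le_antisymm (Submodule.finrank_lt_finrank_of_lt (lt_of_le_of_ne inf_le_left fun heq => ?_))
    (finrank_le_of_inf_ker_le _ _
      (LinearMap.proj (R := ℚ) (φ := fun _ => ℚ) a - LinearMap.proj b) fun v hv hv' => ⟨hv, hv'⟩)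
  have hmem := indicator_mem_fixedFunctions x a
  rw [← heq] at hmem
  simpa [h, Perm.SameCycle.refl] using LinearMap.mem_ker.1 hmem.2

/-- If `a` and `b` were still separated after the multiplication, both spaces of invariants would
meet the hyperplane `f a = f b` in the same space, of codimension one in each. The lengths would
then agree, against parity. So the cycles have been joined, and the previous case applies to the
product. -/
theorem lenT_mul_swap_of_not_sameCycle {x : Perm (Fin (n + 1))} {a b : Fin (n + 1)}
    (h : ¬ x.SameCycle a b) : lenT (x * swap a b) = lenT x + 1 := by
  have hab : a ≠ b := fun h' => h (h' ▸ Perm.SameCycle.refl x a)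
  by_cases h' : (x * swap a b).SameCycle a b
  · have := lenT_mul_swap_of_sameCycle hab h'
    rwa [mul_assoc, swap_mul_self, mul_one, eq_comm] at this
  · exfalso
    have h1 := finrank_inf_ker_of_not_sameCycle h
    have h2 := finrank_inf_ker_of_not_sameCycle h'
    have h3 := lenT_add_cycleCount x
    have h4 := lenT_add_cycleCount (x * swap a b)
    refine lenT_mul_ne (x := x) ⟨a, b, hab, rfl⟩ ?_
    have : ∀ K : Submodule ℚ (Fin (n + 1) → ℚ), K = LinearMap.ker
        (LinearMap.proj (R := ℚ) (φ := fun _ : Fin (n + 1) => ℚ) a - LinearMap.proj b) →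
        fixedFunctions x ⊓ K = fixedFunctions (x * swap a b) ⊓ K := by
      rintro K rfl
      ext f
      simp only [Submodule.mem_inf, LinearMap.mem_ker]
      refine and_congr_left fun hf => (mem_fixedFunctions_mul_swap (sub_eq_zero.1 hf)).symm
    rw [this _ rfl] at h1
    omega

theorem sameCycle_of_lenT_mul_swap_lt {x : Perm (Fin (n + 1))} {a b : Fin (n + 1)}
    (h : lenT (x * swap a b) < lenT x) : x.SameCycle a b := by
  by_contra h'
  have := lenT_mul_swap_of_not_sameCycle h'
  omega

/- ### Noncrossing permutations -/

/-- `k` lies in the open interval from `a` to `b` for the cyclic order; the interval from `a` to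
`a` consists of everything but `a`. -/
def CycIoo (a b k : ℕ) : Prop :=
  (a < b ∧ a < k ∧ k < b) ∨ (b ≤ a ∧ (a < k ∨ k < b))

/-- For every point `e`, the open cyclic interval from `e` to `x e` is invariant under `x`. -/
def IsNC (x : Perm (Fin (n + 1))) : Prop :=
  ∀ e k : Fin (n + 1), CycIoo e (x e) k ↔ CycIoo e (x e) (x k)

theorem iff_of_sameCycle {α : Type*} {x : Perm α} {P : α → Prop} (hP : ∀ k, P k ↔ P (x k))
    {a b : α} (h : x.SameCycle a b) : P a ↔ P b := by
  obtain ⟨k, rfl⟩ := h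
  induction k with
  | zero => simp
  | succ k ih => rw [ih, hP, ← Perm.mul_apply, ← zpow_one_add, add_comm]
  | pred k ih => rw [ih, hP ((x ^ (-(k : ℤ) - 1)) a), ← Perm.mul_apply, ← zpow_one_add, add_sub_cancel]

theorem IsNC.sameCycle {x : Perm (Fin (n + 1))} (hx : IsNC x) (e : Fin (n + 1))
    {a b : Fin (n + 1)} (h : x.SameCycle a b) : CycIoo e (x e) a ↔ CycIoo e (x e) b :=
  iff_of_sameCycle (P := fun k : Fin (n + 1) => CycIoo e (x e) k) (hx e) h

/-- The open arc from `a` to `x a` is invariant and misses `a`, so it misses the whole cycle: `x a`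
is the next point of the cycle in the cyclic order. -/
theorem IsNC.not_sameCycle {x : Perm (Fin (n + 1))} (hx : IsNC x) {a b : Fin (n + 1)}
    (h : x.SameCycle a b) : ¬ CycIoo a (x a) b := by
  rw [← hx.sameCycle a h]
  unfold CycIoo
  omega

/-- Pure arithmetic of the cyclic order, stated for natural numbers so that `omega` decides it. The
primed role is played by variables: `xa` stands for the image of `a`, and so on. -/
theorem cycIoo_split {a b k xa xb xk : ℕ} (h3 : CycIoo k xk a ↔ CycIoo k xk b)
    (h4 : ¬ CycIoo a xa b) (h5 : ¬ CycIoo b xb a) (h2 : CycIoo b xb k ↔ CycIoo b xb xk)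
    (h6 : a ≠ b) (h7 : a ≠ k) (h8 : b ≠ k) (h9 : xa ≠ xb) (h10 : xa ≠ xk) (h11 : xb ≠ xk) :
    CycIoo a xb k ↔ CycIoo a xb xk := by
  unfold CycIoo at *
  omega

theorem val_ne {m : ℕ} {a b : Fin m} (h : a ≠ b) : (a : ℕ) ≠ b := fun h' => h (Fin.ext h')

theorem IsNC.mul_swap_aux {x : Perm (Fin (n + 1))} (hx : IsNC x) {a b : Fin (n + 1)} (hab : a ≠ b)
    (h : x.SameCycle a b) (k : Fin (n + 1)) :
    CycIoo a (x b) k ↔ CycIoo a (x b) ((x * swap a b) k) := by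
  have h4 := hx.not_sameCycle h
  have h5 := hx.not_sameCycle h.symm
  have h9 := val_ne (x.injective.ne hab)
  have h6 := val_ne hab
  rcases eq_or_ne k a with rfl | hka
  · rw [Perm.mul_apply, swap_apply_left]
    unfold CycIoo
    omega
  rcases eq_or_ne k b with rfl | hkb
  · rw [Perm.mul_apply, swap_apply_right]
    unfold CycIoo at *
    omega
  rw [Perm.mul_apply, swap_apply_of_ne_of_ne hka hkb]
  exact cycIoo_split (hx.sameCycle k h) h4 h5 (hx b k) h6 (val_ne hka.symm) (val_ne hkb.symm) h9
    (val_ne (x.injective.ne hka.symm)) (val_ne (x.injective.ne hkb.symm))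

theorem iff_mul_swap {α : Type*} [DecidableEq α] {x : Perm α} {P : α → Prop}
    (hP : ∀ k, P k ↔ P (x k)) {a b : α} (h : P a ↔ P b) (k : α) : P k ↔ P ((x * swap a b) k) := by
  rw [Perm.mul_apply, ← hP]
  rcases eq_or_ne k a with rfl | hka
  · rwa [swap_apply_left]
  rcases eq_or_ne k b with rfl | hkb
  · rw [swap_apply_right, h]
  rw [swap_apply_of_ne_of_ne hka hkb]

/-- Splitting a cycle preserves the arc condition. Only the arcs starting at `a` and `b` change. Any
other arc has `a` and `b` on the same side, so exchanging them does not affect its invariance. -/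
theorem IsNC.mul_swap {x : Perm (Fin (n + 1))} (hx : IsNC x) {a b : Fin (n + 1)}
    (h : x.SameCycle a b) : IsNC (x * swap a b) := by
  rcases eq_or_ne a b with rfl | hab
  · rwa [swap_self, ← Perm.one_def, mul_one]
  intro e k
  rcases eq_or_ne e a with rfl | hea
  · rw [Perm.mul_apply x _ e, swap_apply_left]
    exact hx.mul_swap_aux hab h k
  rcases eq_or_ne e b with rfl | heb
  · rw [Perm.mul_apply x _ e, swap_apply_right, swap_comm]
    exact hx.mul_swap_aux hea h.symm k
  rw [Perm.mul_apply x _ e, swap_apply_of_ne_of_ne hea heb]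
  exact iff_mul_swap (P := fun k : Fin (n + 1) => CycIoo e (x e) k) (hx e) (hx.sameCycle e h) k

/-- The arc at a third point `g` cannot separate the two points `e`, `f` whose cycles are being
joined. -/
theorem cycIoo_merge {e f g xe xf xg : ℕ}
    (h4 : CycIoo e xf g ↔ CycIoo e xf xg) (h5 : CycIoo e xe xf)
    (h6 : g ≠ e) (h7 : g ≠ f) (h8 : xg ≠ xe) (h9 : xg ≠ xf)
    (h10 : CycIoo g xg e ↔ CycIoo g xg xe) (h11 : CycIoo g xg f ↔ CycIoo g xg xf) :
    CycIoo g xg e ↔ CycIoo g xg f := by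
  unfold CycIoo at *
  omega

/-- Joining two cycles that see each other along the arc from `e` to `x f`. -/
theorem IsNC.merge {x : Perm (Fin (n + 1))} (hx : IsNC x) {e f : Fin (n + 1)}
    (h1 : CycIoo e (x e) f) (h2 : ¬ CycIoo e (x f) f)
    (h3 : ∀ k : Fin (n + 1), CycIoo e (x f) k ↔ CycIoo e (x f) (x k)) :
    IsNC (x * swap e f) := by
  have h5 := (hx e f).1 h1
  have hee : ∀ y : Fin (n + 1), ¬ CycIoo e y e := fun y => by unfold CycIoo; omega
  intro g k
  rcases eq_or_ne g e with rfl | hge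
  · rw [Perm.mul_apply x _ g, swap_apply_left]
    exact iff_mul_swap (P := fun k : Fin (n + 1) => CycIoo g (x f) k) h3
      (iff_of_false (hee _) h2) k
  rcases eq_or_ne g f with rfl | hgf
  · rw [Perm.mul_apply x _ g, swap_apply_right]
    -- The new arc at this point is cut out by three arcs that are each invariant under `x`; the
    -- invariance is inherited from them.
    have key : ∀ k : Fin (n + 1), CycIoo g (x e) k ↔
        CycIoo e (x e) k ∧ CycIoo g (x g) k ∧ ¬ CycIoo e (x g) k := by
      intro k
      unfold CycIoo at *
      omega
    refine iff_mul_swap (P := fun k : Fin (n + 1) => CycIoo g (x e) k) (fun k => ?_) ?_ k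
    · rw [key, key, hx e k, hx g k, h3 k]
    · unfold CycIoo at *
      omega
  rw [Perm.mul_apply x _ g, swap_apply_of_ne_of_ne hge hgf]
  exact iff_mul_swap (P := fun k : Fin (n + 1) => CycIoo g (x g) k) (hx g)
    (cycIoo_merge (h3 g) h5 (val_ne hge) (val_ne hgf) (val_ne (x.injective.ne hge))
      (val_ne (x.injective.ne hgf)) (hx g e) (hx g f)) k

/-! ### The Coxeter element and the interval below it -/

theorem simpleRefl_apply (i : Fin n) (k : Fin (n + 1)) :
    (simpleRefl i k : ℕ) = if (k : ℕ) = i then (i : ℕ) + 1 else if (k : ℕ) = i + 1 then i else k := by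
  rw [simpleRefl, swap_apply_def]
  split_ifs <;> simp_all [Fin.ext_iff]

theorem wordProd_cons (i : Fin n) (l : List (Fin n)) :
    wordProd (i :: l) = simpleRefl i * wordProd l := by
  simp [wordProd]

theorem wordProd_append (l l' : List (Fin n)) :
    wordProd (l ++ l') = wordProd l * wordProd l' := by
  simp [wordProd]

theorem coxeterElt_apply (k : Fin (n + 1)) :
    (coxeterElt n k : ℕ) = if (k : ℕ) = n then 0 else (k : ℕ) + 1 := by
  -- The induction runs over the tails of the word `s_1 ⋯ s_n`, the first `m` letters being dropped.
  have key : ∀ d m : ℕ, m + d = n → ∀ k : Fin (n + 1),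
      (wordProd ((List.finRange n).drop m) k : ℕ) =
        if (k : ℕ) < m then (k : ℕ) else if (k : ℕ) = n then m else (k : ℕ) + 1 := by
    intro d
    induction d with
    | zero =>
      intro m hm k
      have := k.2
      rw [List.drop_eq_nil_of_le (by simp; omega)]
      simp only [wordProd, List.map_nil, List.prod_nil, Perm.one_apply]
      split_ifs <;> omega
    | succ d ih =>
      intro m hm k
      have hm' : m < n := by omega
      rw [List.drop_eq_getElem_cons (by simpa using hm'), wordProd_cons, Perm.mul_apply,
        simpleRefl_apply, ih (m + 1) (by omega) k]
      simp only [List.getElem_finRange, Fin.val_cast]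
      split_ifs <;> omega
  simpa [coxeterElt] using key n 0 (by simp) k

theorem isNC_coxeterElt : IsNC (coxeterElt n) := by
  intro e k
  have h1 := coxeterElt_apply e
  have h2 := coxeterElt_apply k
  have h3 := e.2
  have h4 := k.2
  have h5 := (coxeterElt n k).2
  have h6 := (coxeterElt n e).2
  unfold CycIoo
  split_ifs at h1 h2 <;> omega

/-- Descent from `c`. A transposition `t` at the start of a reduced expression of `x⁻¹ c` gives `x
t`, which is longer than `x` and still below `c`. Returning from `x t` to `x` shortens, so it splits
a cycle, and splitting preserves `IsNC`. -/
theorem isNC_of_mem_noncrossing {x : Perm (Fin (n + 1))} (hx : x ∈ noncrossing n) : IsNC x := by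
  have key : ∀ (k : ℕ) (x : Perm (Fin (n + 1))), x ∈ noncrossing n →
      lenT (x⁻¹ * coxeterElt n) = k → IsNC x := by
    intro k
    induction k with
    | zero =>
      intro x _ h
      have := eq_one_of_genLength_eq_zero Perm.mclosure_isSwap h
      rw [inv_mul_eq_one.1 this]
      exact isNC_coxeterElt
    | succ k ih =>
      intro x hx h
      obtain ⟨t, ht, y, h1, h2⟩ := exists_mul_genLength_lt Perm.mclosure_isSwap
        (g := x⁻¹ * coxeterElt n) (fun h' => by simp [h', lenT, genLength_one] at h)
      change lenT y + 1 = lenT (x⁻¹ * coxeterElt n) at h2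
      have htt : t * t = 1 := by obtain ⟨a, b, -, rfl⟩ := ht; exact swap_mul_self _ _
      have hy : (x * t)⁻¹ * coxeterElt n = y := by
        rw [mul_inv_rev, mul_assoc, h1, inv_mul_cancel_left]
      have h3 := lenT_mul_le (x * t) ((x * t)⁻¹ * coxeterElt n)
      rw [mul_inv_cancel_left, hy] at h3
      have h4 : lenT x + lenT (x⁻¹ * coxeterElt n) = lenT (coxeterElt n) := hx
      have h5 := lenT_mul_swap (x := x) ht
      have h6 : lenT (x * t) = lenT x + 1 := by omega
      have h7 := ih (x * t) (by rw [noncrossing, Set.mem_ofPred_eq, hy]; omega) (by rw [hy]; omega)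
      obtain ⟨a, b, hab, rfl⟩ := ht
      have h8 : x = x * swap a b * swap a b := by rw [mul_assoc, swap_mul_self, mul_one]
      rw [h8]
      refine h7.mul_swap (sameCycle_of_lenT_mul_swap_lt ?_)
      rw [← h8]
      omega
  exact key _ x hx rfl

/-- Ascent to `c`. Where `x e ≠ c e`, joining the cycles of `e` and `f = x⁻¹ (c e)` makes the
product agree with `c` at `e` and destroys no agreement elsewhere. The join is noncrossing because
the open arc from `e` to `c e` is empty. Each step costs one transposition and raises the length by
one. -/
theorem IsNC.mem_noncrossing {x : Perm (Fin (n + 1))} (hx : IsNC x) : x ∈ noncrossing n := by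
  have key : ∀ (k : ℕ) (x : Perm (Fin (n + 1))), IsNC x →
      (Finset.univ.filter fun i => x i ≠ coxeterElt n i).card = k →
      lenT x + lenT (x⁻¹ * coxeterElt n) ≤ lenT (coxeterElt n) := by
    intro k
    induction k using Nat.strong_induction_on with
    | _ k ih =>
      intro x hx hk
      by_cases hxc : x = coxeterElt n
      · simp [hxc, lenT, genLength_one]
      obtain ⟨e, he⟩ : ∃ e, x e ≠ coxeterElt n e := by
        by_contra! h
        exact hxc (Equiv.ext h)
      set f := x⁻¹ (coxeterElt n e) with hf
      have hxf : x f = coxeterElt n e := by simp [f]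
      have hef : e ≠ f := by
        intro h
        rw [← h] at hxf
        exact he hxf
      have hc := coxeterElt_apply e
      have h0 := val_ne he
      have h1 : CycIoo e (x e) f := by
        rw [hx e f, hxf]
        have := (x e).2
        unfold CycIoo
        split_ifs at hc <;> omega
      have hempty : ∀ k : Fin (n + 1), ¬ CycIoo e (coxeterElt n e) k := by
        intro k
        have := k.2
        unfold CycIoo
        split_ifs at hc <;> omega
      have hns : ¬ x.SameCycle e f := fun h => hx.not_sameCycle h h1
      have hnc : IsNC (x * swap e f) :=
        hx.merge h1 (by rw [hxf]; exact hempty f)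
          (fun k => by rw [hxf]; exact iff_of_false (hempty _) (hempty _))
      have hlt : (Finset.univ.filter fun i => (x * swap e f) i ≠ coxeterElt n i).card < k := by
        rw [← hk]
        refine Finset.card_lt_card ⟨fun i hi => ?_, fun h => ?_⟩
        · simp only [Finset.mem_filter, Finset.mem_univ, true_and, Perm.mul_apply] at hi ⊢
          rcases eq_or_ne i e with rfl | hie
          · exact he
          rcases eq_or_ne i f with rfl | hif
          · rw [hxf]
            exact fun h => hef ((coxeterElt n).injective h)
          simpa only [Perm.mul_apply, swap_apply_of_ne_of_ne hie hif] using (Finset.mem_filter.1 hi).2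
        · refine (Finset.mem_filter.1 (h (Finset.mem_filter.2 ⟨Finset.mem_univ e, he⟩))).2 ?_
          rw [Perm.mul_apply, swap_apply_left, hxf]
      have h2 := ih _ hlt _ hnc rfl
      have h3 := lenT_mul_swap_of_not_sameCycle hns
      have h4 : x⁻¹ * coxeterElt n = swap e f * ((x * swap e f)⁻¹ * coxeterElt n) := by
        rw [mul_inv_rev, swap_inv, ← mul_assoc, ← mul_assoc, swap_mul_self, one_mul]
      have h5 := lenT_mul_le (swap e f) ((x * swap e f)⁻¹ * coxeterElt n)
      have h6 := lenT_isSwap_le ⟨e, f, hef, rfl⟩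
      rw [h4]
      omega
  refine le_antisymm (key _ x hx rfl) ?_
  simpa using lenT_mul_le x (x⁻¹ * coxeterElt n)

theorem mem_noncrossing_iff {x : Perm (Fin (n + 1))} : x ∈ noncrossing n ↔ IsNC x :=
  ⟨isNC_of_mem_noncrossing, IsNC.mem_noncrossing⟩

/-! ### Excedances of noncrossing permutations -/

/-- The interval under a descending arc is invariant. -/
theorem IsNC.Icc_iff {x : Perm (Fin (n + 1))} (hx : IsNC x) {m : Fin (n + 1)} (hm : x m ≤ m)
    (k : Fin (n + 1)) : (x m ≤ k ∧ k ≤ m) ↔ (x m ≤ x k ∧ x k ≤ m) := by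
  have := hx m k
  unfold CycIoo at this
  simp only [Fin.le_def] at *
  omega

/-- The interval under an ascending arc is invariant. -/
theorem IsNC.Ioo_iff {x : Perm (Fin (n + 1))} (hx : IsNC x) {m : Fin (n + 1)} (hm : m < x m)
    (k : Fin (n + 1)) : (m < k ∧ k < x m) ↔ (m < x k ∧ x k < x m) := by
  have := hx m k
  unfold CycIoo at this
  simp only [Fin.lt_def] at *
  omega

theorem IsNC.le_of_sameCycle {x : Perm (Fin (n + 1))} (hx : IsNC x) {m k : Fin (n + 1)}
    (hm : x m ≤ m) (h : x.SameCycle m k) : x m ≤ k ∧ k ≤ m :=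
  (iff_of_sameCycle (P := fun k => x m ≤ k ∧ k ≤ m) (hx.Icc_iff hm) h).1 ⟨hm, le_rfl⟩

/-- If `x m ≤ m`, the interval from `x m` to `m` is invariant, so it contains the cycle and `m` is
its maximum. -/
theorem IsNC.mem_setD {x : Perm (Fin (n + 1))} (hx : IsNC x) {m : Fin (n + 1)} :
    m ∈ setD x ↔ m < x m := by
  refine ⟨fun h => ?_, fun h => ⟨h.ne', fun h' => ?_⟩⟩
  · by_contra h'
    exact h.2 fun k hk => (hx.le_of_sameCycle (not_lt.1 h') hk).2
  · exact absurd (h' (x m) ⟨1, by simp⟩) (not_le.2 h)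

theorem IsNC.mem_setU {x : Perm (Fin (n + 1))} (hx : IsNC x) {m : Fin (n + 1)} :
    m ∈ setU x ↔ x⁻¹ m < m := by
  refine ⟨fun h => ?_, fun h => ⟨fun h' => ?_, fun h' => ?_⟩⟩
  · by_contra h'
    refine h.2 fun k hk => ?_
    have hm : x (x⁻¹ m) = m := by simp
    have := hx.le_of_sameCycle (m := x⁻¹ m) (k := k) (by rw [hm]; exact not_lt.1 h')
      (Perm.SameCycle.trans ⟨1, by simp⟩ hk)
    rw [hm] at this
    exact this.1
  · exact h.ne (Perm.inv_eq_iff_eq.2 h'.symm)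
  · exact absurd (h' (x⁻¹ m) ⟨-1, by simp⟩) (not_le.2 h)

/- ### Band generators in groups with braid relations -/

section Band

variable {G : Type*} [Group G]

/-- The braid relations for a sequence of elements, of which the first `n` are of interest. -/
structure IsBraidSeq (n : ℕ) (s : ℕ → G) : Prop where
  comm : ∀ i j, i + 1 < j → Commute (s i) (s j)
  braid : ∀ i, i + 1 < n → s i * s (i + 1) * s i = s (i + 1) * s i * s (i + 1)

/-- The conjugate `s_{a+d}⁻¹ ⋯ s_{a+1}⁻¹ s_a s_{a+1} ⋯ s_{a+d}`. -/
def bandAux (s : ℕ → G) (a : ℕ) : ℕ → G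
  | 0 => s a
  | d + 1 => (s (a + d + 1))⁻¹ * bandAux s a d * s (a + d + 1)

/-- The conjugate `s_{b-1}⁻¹ ⋯ s_{a+1}⁻¹ s_a s_{a+1} ⋯ s_{b-1}`. -/
def band (s : ℕ → G) (a b : ℕ) : G := bandAux s a (b - (a + 1))

variable {n : ℕ} {s : ℕ → G}

theorem band_self_succ (a : ℕ) : band s a (a + 1) = s a := by
  simp [band, bandAux]

theorem band_succ {a b : ℕ} (h : a < b) : band s a (b + 1) = (s b)⁻¹ * band s a b * s b := by
  obtain ⟨d, rfl⟩ := Nat.exists_eq_add_of_lt h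
  have h1 : a + d + 1 + 1 - (a + 1) = d + 1 := by omega
  have h2 : a + d + 1 - (a + 1) = d := by omega
  rw [band, band, h1, h2, bandAux]

/-- An element commuting with all letters commutes with the band generator. -/
theorem commute_band {g : G} {a b : ℕ} (hab : a < b) (h : ∀ k, a ≤ k → k < b → Commute g (s k)) :
    Commute g (band s a b) := by
  induction b, hab using Nat.le_induction with
  | base => rw [band_self_succ]; exact h a le_rfl (by omega)
  | succ b hb ih =>
    rw [band_succ hb]
    have h1 := h b (by omega) (by omega)
    exact (h1.inv_right.mul_right (ih fun k hk hk' => h k hk (by omega))).mul_right h1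

namespace IsBraidSeq

variable (hs : IsBraidSeq n s)
include hs

theorem comm' {i j : ℕ} (h : i + 1 < j ∨ j + 1 < i) : Commute (s i) (s j) :=
  h.elim (hs.comm i j) fun h => (hs.comm j i h).symm

theorem commute_outside {k a b : ℕ} (hab : a < b) (h : k + 1 < a ∨ b < k) :
    Commute (s k) (band s a b) :=
  commute_band hab fun i h1 h2 => hs.comm' (by omega)

/-- The case `b = k + 2` is where the braid relation enters; each later conjugation is by a letter
commuting with `s k`. -/
theorem commute_inside {k a b : ℕ} (hak : a < k) (hkb : k + 1 < b) (hb : b ≤ n) :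
    Commute (s k) (band s a b) := by
  induction b, (show k + 2 ≤ b from hkb) using Nat.le_induction with
  | base =>
    rw [band_succ (by omega), band_succ hak]
    have h1 : Commute (s (k + 1)) (band s a k) := hs.commute_outside hak (by omega)
    have h2 := hs.braid k (by omega)
    have h3 : s (k + 1) * (s k * s (k + 1)) = s k * s (k + 1) * s k := by
      rw [← mul_assoc, h2]
    have h4 : s k * ((s (k + 1))⁻¹ * (s k)⁻¹) = (s (k + 1))⁻¹ * (s k)⁻¹ * s (k + 1) := by
      rw [← mul_inv_rev, eq_inv_mul_iff_mul_eq, ← mul_assoc, ← h3, mul_inv_cancel_right]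
    change _ = _
    calc s k * ((s (k + 1))⁻¹ * ((s k)⁻¹ * band s a k * s k) * s (k + 1))
        = s k * ((s (k + 1))⁻¹ * (s k)⁻¹) * band s a k * (s k * s (k + 1)) := by group
      _ = (s (k + 1))⁻¹ * (s k)⁻¹ * (s (k + 1) * band s a k) * (s k * s (k + 1)) := by
          rw [h4]; group
      _ = (s (k + 1))⁻¹ * (s k)⁻¹ * band s a k * (s (k + 1) * (s k * s (k + 1))) := by
          rw [h1.eq]; group
      _ = _ := by rw [h3]; group
  | succ b hb' ih =>
    rw [band_succ (by omega)]
    have h1 : Commute (s k) (s b) := hs.comm k b (by omega)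
    exact (h1.inv_right.mul_right (ih (by omega) (by omega))).mul_right h1

theorem braid_band {a b : ℕ} (hab : a < b) (hb : b < n) :
    band s a b * s b * band s a b = s b * band s a b * s b := by
  induction b, hab using Nat.le_induction with
  | base => rw [band_self_succ]; exact hs.braid a hb
  | succ b hb' ih =>
    have h1 := ih (by omega)
    have h2 : band s a (b + 1) = band s a b * s b * (band s a b)⁻¹ := by
      rw [band_succ hb', eq_mul_inv_iff_mul_eq, mul_assoc, mul_assoc, inv_mul_eq_iff_eq_mul,
        ← mul_assoc, h1, mul_assoc]
    have h3 : Commute (s (b + 1)) (band s a b) := hs.commute_outside hb' (by omega)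
    have h4 := hs.braid b hb
    have h5 : s (b + 1) = band s a b * s (b + 1) * (band s a b)⁻¹ := by
      rw [← h3.eq, mul_inv_cancel_right]
    rw [h2]
    generalize band s a b = A at *
    calc A * s b * A⁻¹ * s (b + 1) * (A * s b * A⁻¹)
        = A * s b * A⁻¹ * (A * s (b + 1) * A⁻¹) * (A * s b * A⁻¹) := by rw [← h5]
      _ = A * (s b * s (b + 1) * s b) * A⁻¹ := by group
      _ = (A * s (b + 1) * A⁻¹) * (A * s b * A⁻¹) * (A * s (b + 1) * A⁻¹) := by rw [h4]; group
      _ = _ := by rw [← h5]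

/-- With `band_mul_band_right`, this gives the Birman–Ko–Lee relations: the three factorizations of
a 3-cycle below `c` into two transpositions have the same lift. -/
theorem band_mul_band_left {a b c : ℕ} (hab : a < b) (hbc : b < c) :
    band s b c * band s a c = band s a b * band s b c := by
  induction c, hbc using Nat.le_induction with
  | base => rw [band_self_succ, band_succ hab]; group
  | succ c hc ih =>
    have h1 : Commute (s c) (band s a b) := hs.commute_outside hab (by omega)
    rw [band_succ hc, band_succ (show a < c by omega)]
    calc (s c)⁻¹ * band s b c * s c * ((s c)⁻¹ * band s a c * s c)
        = (s c)⁻¹ * (band s b c * band s a c) * s c := by group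
      _ = (s c)⁻¹ * band s a b * band s b c * s c := by rw [ih]; group
      _ = band s a b * ((s c)⁻¹ * band s b c * s c) := by
          rw [h1.inv_left.eq]; group

theorem band_mul_band_right {a b c : ℕ} (hab : a < b) (hbc : b < c) (hc : c ≤ n) :
    band s a c * band s a b = band s a b * band s b c := by
  induction c, hbc using Nat.le_induction with
  | base =>
    have h1 := hs.braid_band hab hc
    rw [band_self_succ, band_succ hab, mul_assoc, mul_assoc, inv_mul_eq_iff_eq_mul, ← mul_assoc,
      h1, mul_assoc]
  | succ c hc' ih =>
    have h1 : Commute (s c) (band s a b) := hs.commute_outside hab (by omega)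
    rw [band_succ hc', band_succ (show a < c by omega)]
    calc (s c)⁻¹ * band s a c * s c * band s a b
        = (s c)⁻¹ * (band s a c * band s a b) * s c := by rw [mul_assoc, h1.eq]; group
      _ = (s c)⁻¹ * band s a b * band s b c * s c := by rw [ih (by omega)]; group
      _ = band s a b * ((s c)⁻¹ * band s b c * s c) := by
          rw [h1.inv_left.eq]; group

/-- The four configurations are those of two noncrossing chords without a common endpoint: side by
side or nested. -/
theorem commute_band_band {a b c d : ℕ} (hab : a < b) (hcd : c < d) (hb : b ≤ n) (hd : d ≤ n)
    (h : b < c ∨ d < a ∨ (a < c ∧ d < b) ∨ (c < a ∧ b < d)) :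
    Commute (band s a b) (band s c d) := by
  rcases h with h | h | ⟨h, h'⟩ | ⟨h, h'⟩
  · exact commute_band hcd fun k h1 h2 => (hs.commute_outside hab (by omega)).symm
  · exact commute_band hcd fun k h1 h2 => (hs.commute_outside hab (by omega)).symm
  · exact commute_band hcd fun k h1 h2 => (hs.commute_inside (by omega) (by omega) hb).symm
  · exact (commute_band hab fun k h1 h2 =>
      (hs.commute_inside (by omega) (by omega) hd).symm).symm

end IsBraidSeq

end Band

/- ### The braid group -/

/-- The Artin generators, as a sequence. -/
def braidSeq (n k : ℕ) : BraidGroup n :=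
  -- With the default value `1` the commutation relations hold for all indices; the braid relation
  -- does not extend past `n`, which is why `IsBraidSeq` bounds it.
  if h : k < n then braidGen ⟨k, h⟩ else 1

theorem isBraidSeq_braidSeq (n : ℕ) : IsBraidSeq n (braidSeq n) where
  comm i j h := by
    unfold braidSeq
    split_ifs with h1 h2 h2
    · have := PresentedGroup.one_of_mem (rels := {r | BraidRel n r})
        (BraidRel.comm ⟨i, h1⟩ ⟨j, h2⟩ (Or.inl h))
      rw [map_mul, map_inv, mul_inv_eq_one] at this
      simp only [map_mul] at this
      exact this
    · exact Commute.one_right _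
    · exact Commute.one_left _
    · exact Commute.one_left _
  braid i h := by
    have h1 : i < n := by omega
    have := PresentedGroup.one_of_mem (rels := {r | BraidRel n r})
      (BraidRel.braid ⟨i, h1⟩ ⟨i + 1, h⟩ rfl)
    rw [map_mul, map_inv, mul_inv_eq_one] at this
    rw [braidSeq, braidSeq, dif_pos h1, dif_pos h]
    simp only [map_mul] at this
    exact this

theorem finRange_filter_succ {a b : ℕ} (hab : a < b) (hb : b < n) :
    ((List.finRange n).filter fun k : Fin n => a < (k : ℕ) ∧ (k : ℕ) < b + 1) =
      ((List.finRange n).filter fun k : Fin n => a < (k : ℕ) ∧ (k : ℕ) < b) ++ [⟨b, hb⟩] := by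
  have hs := List.pairwise_lt_finRange n
  refine List.Perm.eq_of_pairwise (le := (· < ·)) (fun x y _ _ h h' => absurd h h'.asymm)
    (hs.filter _) ?_ ?_
  · rw [List.pairwise_append]
    refine ⟨hs.filter _, by simp, fun x hx y hy => ?_⟩
    simp only [List.mem_filter, List.mem_finRange, true_and, decide_eq_true_eq,
      List.mem_singleton] at hx hy
    subst hy
    exact hx.2
  · rw [List.perm_ext_iff_of_nodup ((List.nodup_finRange n).filter _)]
    · intro x
      simp only [List.mem_filter, List.mem_finRange, true_and, decide_eq_true_eq,
        List.mem_append, List.mem_singleton, Fin.ext_iff]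
      omega
    · rw [List.nodup_append]
      refine ⟨(List.nodup_finRange n).filter _, by simp, fun x hx y hy => ?_⟩
      simp only [List.mem_filter, List.mem_finRange, true_and, decide_eq_true_eq,
        List.mem_singleton] at hx hy
      subst hy
      exact fun h => hx.2.ne (congrArg Fin.val h)

theorem syllable_eq_band (t : Transp n) :
    syllable t = band (braidSeq n) (t.1.1 : ℕ) (t.1.2 : ℕ) := by
  have key : ∀ a : Fin n, ∀ b : ℕ, (a : ℕ) < b → b ≤ n →
      (((((List.finRange n).filter fun k : Fin n => (a : ℕ) < (k : ℕ) ∧ (k : ℕ) < b).map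
        braidGen).prod)⁻¹ * braidGen a *
          (((List.finRange n).filter fun k : Fin n => (a : ℕ) < (k : ℕ) ∧ (k : ℕ) < b).map
            braidGen).prod : BraidGroup n) = band (braidSeq n) a b := by
    intro a b hab
    induction b, hab using Nat.le_induction with
    | base =>
      intro _
      have : ((List.finRange n).filter fun k : Fin n =>
          (a : ℕ) < (k : ℕ) ∧ (k : ℕ) < (a : ℕ) + 1) = [] := by
        simp only [List.filter_eq_nil_iff, decide_eq_true_eq]
        omega
      rw [band_self_succ, Nat.succ_eq_add_one, this, braidSeq, dif_pos a.2]
      simp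
    | succ b hb ih =>
      intro hbn
      have := ih (by omega)
      rw [finRange_filter_succ hb (by omega), band_succ hb, ← this, braidSeq,
        dif_pos (show b < n by omega), List.map_append, List.prod_append]
      simp only [List.map_cons, List.map_nil, List.prod_cons, List.prod_nil, mul_one]
      group
  have h1 := t.2
  have h2 := t.1.2.2
  exact key ⟨t.1.1, by omega⟩ t.1.2 h1 (by omega)

/- ### The lift of a noncrossing permutation -/

/-- The lift of a permutation fixing all points from `N` on, obtained by removing the largest moved
point again and again. -/
def ncLift : ℕ → Perm (Fin (n + 1)) → BraidGroup n
  | 0, _ => 1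
  | N + 1, x =>
    if h : N < n + 1 then
      if x ⟨N, h⟩ = ⟨N, h⟩ then ncLift N x
      else ncLift N (x * swap (x⁻¹ ⟨N, h⟩) ⟨N, h⟩) * band (braidSeq n) (x⁻¹ ⟨N, h⟩) N
    else ncLift N x

theorem ncLift_succ_of_fixed {m : Fin (n + 1)} {x : Perm (Fin (n + 1))} (h : x m = m) :
    ncLift (m + 1) x = ncLift m x := by
  rw [ncLift, dif_pos m.2, if_pos h]

theorem ncLift_succ_of_moved {m p : Fin (n + 1)} {x : Perm (Fin (n + 1))} (hp : p ≠ m)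
    (h : x p = m) : ncLift (m + 1) x = ncLift m (x * swap p m) * band (braidSeq n) p m := by
  have h1 : x⁻¹ m = p := Perm.inv_eq_iff_eq.2 h.symm
  rw [ncLift, dif_pos m.2, if_neg, Fin.eta, h1]
  rw [Fin.eta]
  exact fun h' => hp (x.injective (h.trans h'.symm))

/-- The product fixes `m` and otherwise bypasses it. Placing `m` in the class of its predecessor `p`
turns the cycles of the product into an invariant of `x`. -/
theorem sameCycle_mul_swap_of_ne {α : Type*} [DecidableEq α] {x : Perm α} {p m a b : α}
    (hpm : p ≠ m) (hp : x p = m) (ha : a ≠ m) (hb : b ≠ m) (h : x.SameCycle a b) :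
    (x * swap p m).SameCycle a b := by
  set y := x * swap p m with hy
  have hyp : y p = x m := by rw [hy, Perm.mul_apply, swap_apply_left]
  have hxm : x m ≠ m := fun h' => hpm (x.injective (hp.trans h'.symm))
  have key : ∀ k, (if k = m then y.SameCycle a p else y.SameCycle a k) ↔
      (if x k = m then y.SameCycle a p else y.SameCycle a (x k)) := by
    intro k
    rcases eq_or_ne k m with rfl | hkm
    · rw [if_pos rfl, if_neg hxm, ← hyp, Perm.sameCycle_apply_right]
    rcases eq_or_ne k p with rfl | hkp
    · rw [if_neg hkm, if_pos hp]
    have h1 : x k ≠ m := fun h' => hkp (x.injective (h'.trans hp.symm))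
    have h2 : y k = x k := by rw [hy, Perm.mul_apply, swap_apply_of_ne_of_ne hkp hkm]
    rw [if_neg hkm, if_neg h1, ← h2, Perm.sameCycle_apply_right]
  have := iff_of_sameCycle key h
  rw [if_neg ha, if_neg hb] at this
  exact this.1 (Perm.SameCycle.refl _ _)

theorem swap_mul_swap_right {α : Type*} [DecidableEq α] {a b c : α} (hab : a ≠ b) (hac : a ≠ c) :
    swap a c * swap b c = swap b c * swap a b := by
  rw [mul_swap_eq_swap_mul (swap b c), swap_apply_of_ne_of_ne hab hac, swap_apply_left]

/-- Every transposition splitting a cycle of `x` can be made the last letter, by induction on the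
largest point `m` that may move. Let `p` be the preimage of a moved `m`. The cases `b = m` and `b =
p` use the two relations for bands sharing an endpoint. Otherwise the chords `(a, b)` and `(p, m)`
have no common endpoint and do not cross, so their lifts commute. -/
theorem ncLift_mul_swap (N : ℕ) (hN : N ≤ n + 1) : ∀ {x : Perm (Fin (n + 1))}, IsNC x →
    (∀ k : Fin (n + 1), N ≤ k → x k = k) → ∀ {a b : Fin (n + 1)}, a < b → x.SameCycle a b →
    ncLift N x = ncLift N (x * swap a b) * band (braidSeq n) a b := by
  have hs := isBraidSeq_braidSeq n
  have hmoved : ∀ {x : Perm (Fin (n + 1))} {a b : Fin (n + 1)}, x.SameCycle a b → a ≠ b →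
      x b ≠ b := by
    intro x a b h hab hb
    exact hab ((h.symm.eq_of_left hb).symm)
  induction N with
  | zero =>
    intro x hx hfix a b hab h
    exact absurd (hfix b (Nat.zero_le _)) (hmoved h hab.ne)
  | succ N ih =>
    have ih := @ih (by omega)
    intro x hx hfix a b hab h
    have hbN : (b : ℕ) ≤ N := by
      by_contra! hb
      exact hmoved h hab.ne (hfix b hb)
    obtain ⟨m, rfl⟩ : ∃ m : Fin (n + 1), (m : ℕ) = N := ⟨⟨N, hN⟩, rfl⟩
    by_cases hm : x m = m
    · have hbm : b ≠ m := by
        rintro rfl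
        exact hmoved h hab.ne hm
      have ham : a ≠ m := by
        rintro rfl
        exact hmoved h.symm hab.ne' hm
      rw [ncLift_succ_of_fixed hm, ncLift_succ_of_fixed]
      · refine ih hx (fun k hk => ?_) hab h
        rcases hk.eq_or_lt with hk | hk
        · rwa [← Fin.ext hk]
        · exact hfix k hk
      · rw [Perm.mul_apply, swap_apply_of_ne_of_ne ham.symm hbm.symm, hm]
    obtain ⟨p, hp⟩ := x.surjective m
    have hpm : p ≠ m := fun h' => hm (by rwa [h'] at hp)
    have hpm' : p < m := by
      refine lt_of_le_of_ne (not_lt.1 fun h' => ?_) hpm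
      exact hpm ((hfix p h').symm.trans hp)
    have hscp : x.SameCycle p m := ⟨1, by simpa using hp⟩
    have hy := hx.mul_swap hscp
    have hfixy : ∀ k : Fin (n + 1), (m : ℕ) ≤ k → (x * swap p m) k = k := by
      intro k hk
      rw [Perm.mul_apply]
      rcases hk.eq_or_lt with hk | hk
      · rw [← Fin.ext hk, swap_apply_right, hp]
      · rw [swap_apply_of_ne_of_ne, hfix k hk]
        · exact (hpm'.trans hk).ne'
        · exact (Fin.lt_def.2 hk).ne'
    have hmn := m.2
    rw [ncLift_succ_of_moved hpm hp]
    rcases eq_or_ne b m with rfl | hbm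
    · rcases eq_or_ne a p with rfl | hap
      · rw [ncLift_succ_of_fixed (x := x * swap a b)]
        rw [Perm.mul_apply, swap_apply_right, hp]
      · have hap' : a < p := by
          have := hx.not_sameCycle (hscp.trans h.symm)
          have h' := val_ne hap
          rw [hp] at this
          unfold CycIoo at this
          simp only [Fin.lt_def] at *
          omega
        have h1 : (x * swap a b) p = b := by
          rw [Perm.mul_apply, swap_apply_of_ne_of_ne hap.symm hpm, hp]
        rw [ncLift_succ_of_moved hpm h1, mul_assoc x, swap_mul_swap_right hap hab.ne, ← mul_assoc,
          mul_assoc (ncLift _ _), hs.band_mul_band_left hap' hpm', ← mul_assoc,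
          ← ih hy hfixy hap' (sameCycle_mul_swap_of_ne hpm hp hab.ne hpm (h.trans hscp.symm))]
    · have hbm' : b < m := lt_of_le_of_ne hbN hbm
      have ham : a ≠ m := (hab.trans hbm').ne
      rw [ih hy hfixy hab (sameCycle_mul_swap_of_ne hpm hp ham hbm h)]
      rcases eq_or_ne b p with rfl | hbp
      · have h1 : (x * swap a b) a = m := by rw [Perm.mul_apply, swap_apply_left, hp]
        rw [ncLift_succ_of_moved ham h1, mul_assoc x (swap a b), mul_assoc x, 
          show swap a b * swap a m = swap b m * swap a b by
            rw [mul_swap_eq_swap_mul (swap a b), swap_apply_left,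
              swap_apply_of_ne_of_ne ham.symm hbm.symm], ← mul_assoc x, mul_assoc (ncLift _ _), mul_assoc (ncLift _ _),
          hs.band_mul_band_right hab hbm' (by omega)]
      · have hap : a ≠ p := by
          rintro rfl
          have := hx.not_sameCycle h
          rw [hp] at this
          unfold CycIoo at this
          simp only [Fin.lt_def] at *
          omega
        have h1 : (x * swap a b) p = m := by
          rw [Perm.mul_apply, swap_apply_of_ne_of_ne hap.symm hbp.symm, hp]
        have h2 : swap a b * swap p m = swap p m * swap a b := by
          rw [mul_swap_eq_swap_mul (swap a b), swap_apply_of_ne_of_ne hap.symm hbp.symm,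
            swap_apply_of_ne_of_ne ham.symm hbm.symm]
        rw [ncLift_succ_of_moved hpm h1, mul_assoc x (swap a b), h2, ← mul_assoc x,
          mul_assoc (ncLift _ _), mul_assoc (ncLift _ _), 
          (hs.commute_band_band hab hpm' (by omega) (by omega) ?_).eq]
        -- The arc from `p` to `m` contains both `a` and `b` or neither, which is the noncrossing
        -- hypothesis of `commute_band_band`.
        have h3 := hx.sameCycle p h
        have h4 := val_ne hap
        have h5 := val_ne hbp
        have h6 := val_ne hbm
        rw [hp] at h3
        unfold CycIoo at h3
        simp only [Fin.lt_def] at *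
        omega

/-- The product of the lifts of the letters of a reduced expression of a noncrossing permutation
does not depend on the expression. -/
theorem prod_syllable_eq {l : List (Transp n)} {x : Perm (Fin (n + 1))} (hx : IsNC x)
    (hl : IsReducedTransp l x) : (l.map syllable).prod = ncLift (n + 1) x := by
  induction l using List.reverseRecOn generalizing x with
  | nil =>
    have h1 : x = 1 := hl.1.symm
    have : ∀ N, ncLift N (1 : Perm (Fin (n + 1))) = 1 := by
      intro N
      induction N with
      | zero => rfl
      | succ N ih => simp [ncLift, ih]
    simp [h1, this]
  | append_singleton l t ih =>
    obtain ⟨h1, h2⟩ := hl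
    have h3 : (l.map Transp.toPerm).prod = x * swap t.1.1 t.1.2 := by
      rw [← h1, List.map_append, List.prod_append]
      simp [Transp.toPerm, mul_assoc]
    have h4 : lenT (x * swap t.1.1 t.1.2) ≤ l.length := by
      rw [← h3, ← List.length_map (f := Transp.toPerm) (as := l)]
      refine genLength_le fun y hy => ?_
      obtain ⟨s, -, rfl⟩ := List.mem_map.1 hy
      exact ⟨_, _, s.2.ne, rfl⟩
    rw [List.length_append, List.length_singleton] at h2
    have h5 := sameCycle_of_lenT_mul_swap_lt (x := x) (a := t.1.1) (b := t.1.2) (by omega)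
    have h6 := lenT_mul_swap_of_sameCycle t.2.ne h5
    rw [List.map_append, List.prod_append, ih (hx.mul_swap h5) ⟨h3, by omega⟩,
      ncLift_mul_swap (n + 1) le_rfl hx (fun k hk => absurd k.2 (by omega)) t.2 h5]
    simp [syllable_eq_band]

theorem prod_syllable_eq_simpleElt {l : List (Transp n)} {x : Perm (Fin (n + 1))} (hx : IsNC x)
    (hl : IsReducedTransp l x) : (l.map syllable).prod = simpleElt x := by
  rw [prod_syllable_eq hx hl, simpleElt, prod_syllable_eq hx (exists_isReducedTransp x).choose_spec]

/-! ### Simple letters at the ends of a lift -/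

/-- A simple transposition, as a pair of points. -/
def simpleTransp (i : Fin n) : Transp n :=
  ⟨(i.castSucc, i.succ), i.castSucc_lt_succ⟩

theorem syllable_simpleTransp (i : Fin n) : syllable (simpleTransp i) = braidGen i := by
  rw [syllable_eq_band]
  change band (braidSeq n) (i : ℕ) (i + 1 : ℕ) = _
  rw [band_self_succ, braidSeq, dif_pos i.2]

/-- The expression chosen for `x`, preceded by the letter, is reduced for the product. It need not
be the one chosen for the product, but independence of the expression makes the lifts equal. -/
theorem simpleElt_simpleRefl_mul {x : Perm (Fin (n + 1))} {i : Fin n}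
    (hx' : IsNC (simpleRefl i * x)) (h : lenT (simpleRefl i * x) = lenT x + 1) :
    simpleElt (simpleRefl i * x) = braidGen i * simpleElt x := by
  have hc := (exists_isReducedTransp x).choose_spec
  rw [← prod_syllable_eq_simpleElt (l := simpleTransp i :: (exists_isReducedTransp x).choose) hx']
  · rw [List.map_cons, List.prod_cons, syllable_simpleTransp]
    rfl
  · refine ⟨?_, by rw [List.length_cons, hc.2, h]⟩
    rw [List.map_cons, List.prod_cons, hc.1]
    rfl

theorem simpleElt_mul_simpleRefl {x : Perm (Fin (n + 1))} {i : Fin n}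
    (hx' : IsNC (x * simpleRefl i)) (h : lenT (x * simpleRefl i) = lenT x + 1) :
    simpleElt (x * simpleRefl i) = simpleElt x * braidGen i := by
  have hc := (exists_isReducedTransp x).choose_spec
  rw [← prod_syllable_eq_simpleElt (l := (exists_isReducedTransp x).choose ++ [simpleTransp i]) hx']
  · rw [List.map_append, List.prod_append, List.map_singleton, List.prod_singleton,
      syllable_simpleTransp]
    rfl
  · refine ⟨?_, by rw [List.length_append, hc.2, h, List.length_singleton]⟩
    rw [List.map_append, List.prod_append, hc.1, List.map_singleton, List.prod_singleton]
    rfl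

theorem omega_braidGen (i : Fin n) :
    omega n (MonoidAlgebra.of Scalars (BraidGroup n) (braidGen i)) =
      vPow (-1) • (1 : TL n) - tlGen i := by
  rw [omega, MonoidAlgebra.lift_of]
  change ((PresentedGroup.toGroup braidImage_rel (PresentedGroup.of i) : (TL n)ˣ) : TL n) = _
  rw [PresentedGroup.toGroup.of]
  rfl

theorem zinno_simpleRefl_mul {x : Perm (Fin (n + 1))} {i : Fin n}
    (hx' : IsNC (simpleRefl i * x)) (h : lenT (simpleRefl i * x) = lenT x + 1) :
    zinno (simpleRefl i * x) = (vPow (-1) • (1 : TL n) - tlGen i) * zinno x := by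
  rw [zinno, simpleElt_simpleRefl_mul hx' h, map_mul, map_mul, omega_braidGen, zinno]

theorem zinno_mul_simpleRefl {x : Perm (Fin (n + 1))} {i : Fin n}
    (hx' : IsNC (x * simpleRefl i)) (h : lenT (x * simpleRefl i) = lenT x + 1) :
    zinno (x * simpleRefl i) = zinno x * (vPow (-1) • (1 : TL n) - tlGen i) := by
  rw [zinno, simpleElt_mul_simpleRefl hx' h, map_mul, map_mul, omega_braidGen, zinno]

/- ### The Coxeter length and inversions -/

/-- The inversions of a permutation. -/
def inversions (w : Perm (Fin (n + 1))) : Finset (Fin (n + 1) × Fin (n + 1)) :=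
  Finset.univ.filter fun p => p.1 < p.2 ∧ w p.2 < w p.1

theorem mem_inversions {w : Perm (Fin (n + 1))} {p : Fin (n + 1) × Fin (n + 1)} :
    p ∈ inversions w ↔ p.1 < p.2 ∧ w p.2 < w p.1 := by
  simp [inversions]

theorem simpleRefl_castSucc (i : Fin n) : simpleRefl i i.castSucc = i.succ := swap_apply_left _ _

theorem simpleRefl_succ (i : Fin n) : simpleRefl i i.succ = i.castSucc := swap_apply_right _ _

@[simp]
theorem simpleRefl_simpleRefl (i : Fin n) (k : Fin (n + 1)) : simpleRefl i (simpleRefl i k) = k :=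
  swap_apply_self _ _ _

theorem simpleRefl_inv (i : Fin n) : (simpleRefl i)⁻¹ = simpleRefl i := swap_inv _ _

/-- Applying the simple transposition to both entries carries inversions to inversions; the only new
one is the pair of exchanged neighbours. -/
theorem card_inversions_mul_simpleRefl {w : Perm (Fin (n + 1))} {i : Fin n}
    (h : w i.castSucc < w i.succ) :
    (inversions (w * simpleRefl i)).card = (inversions w).card + 1 := by
  have key : inversions (w * simpleRefl i) = insert (i.castSucc, i.succ)
      ((inversions w).image fun p => (simpleRefl i p.1, simpleRefl i p.2)) := by
    ext ⟨a, b⟩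
    have himg : (a, b) ∈ (inversions w).image (fun p => (simpleRefl i p.1, simpleRefl i p.2)) ↔
        simpleRefl i a < simpleRefl i b ∧ w (simpleRefl i b) < w (simpleRefl i a) := by
      rw [Finset.mem_image]
      constructor
      · rintro ⟨⟨c, d⟩, h1, h2⟩
        simp only [Prod.mk.injEq] at h2
        rw [← h2.1, ← h2.2, simpleRefl_simpleRefl, simpleRefl_simpleRefl]
        exact mem_inversions.1 h1
      · intro h1
        exact ⟨(simpleRefl i a, simpleRefl i b), mem_inversions.2 h1, by simp⟩
    rw [Finset.mem_insert, himg, mem_inversions]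
    simp only [Perm.mul_apply, Prod.mk.injEq]
    by_cases h1 : a = i.castSucc ∧ b = i.succ
    · rw [h1.1, h1.2, simpleRefl_castSucc, simpleRefl_succ]
      simp [h, i.castSucc_lt_succ]
    by_cases h2 : a = i.succ ∧ b = i.castSucc
    · rw [h2.1, h2.2, simpleRefl_castSucc, simpleRefl_succ]
      have h3 := i.castSucc_lt_succ
      simp [h3.asymm, h.asymm, h3.ne, h3.ne']
    have h3 : a < b ↔ simpleRefl i a < simpleRefl i b := by
      have ha := simpleRefl_apply i a
      have hb := simpleRefl_apply i b
      simp only [Fin.ext_iff, Fin.val_castSucc, Fin.val_succ, Fin.lt_def] at *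
      split_ifs at ha hb <;> omega
    rw [h3]
    tauto
  rw [key, Finset.card_insert_of_notMem, Finset.card_image_of_injective]
  · rintro ⟨a, b⟩ ⟨c, d⟩ hab
    simpa using hab
  · rw [Finset.mem_image]
    rintro ⟨⟨c, d⟩, h1, h2⟩
    simp only [Prod.mk.injEq] at h2
    have hc : c = i.succ := by rw [← simpleRefl_simpleRefl i c, h2.1, simpleRefl_castSucc]
    have hd : d = i.castSucc := by rw [← simpleRefl_simpleRefl i d, h2.2, simpleRefl_succ]
    subst hc hd
    exact absurd (mem_inversions.1 h1).1 i.castSucc_lt_succ.asymm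

theorem card_inversions_mul_simpleRefl_of_gt {w : Perm (Fin (n + 1))} {i : Fin n}
    (h : w i.succ < w i.castSucc) :
    (inversions (w * simpleRefl i)).card + 1 = (inversions w).card := by
  have := card_inversions_mul_simpleRefl (w := w * simpleRefl i) (i := i)
    (by simpa only [Perm.mul_apply, simpleRefl_castSucc, simpleRefl_succ] using h)
  rw [mul_assoc, simpleRefl_mul_self, mul_one] at this
  exact this.symm

theorem card_inversions_wordProd_le (l : List (Fin n)) :
    (inversions (wordProd l)).card ≤ l.length := by
  induction l using List.reverseRecOn with
  | nil =>
    rw [List.length_nil, Nat.le_zero, Finset.card_eq_zero, Finset.eq_empty_iff_forall_notMem]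
    intro p hp
    exact absurd (mem_inversions.1 hp).1 (mem_inversions.1 hp).2.asymm
  | append_singleton l i ih =>
    rw [wordProd_append, List.length_append, List.length_singleton]
    have h1 : wordProd [i] = simpleRefl i := by simp [wordProd]
    rw [h1]
    rcases lt_or_gt_of_ne ((wordProd l).injective.ne i.castSucc_lt_succ.ne) with h | h
    · rw [card_inversions_mul_simpleRefl h]
      omega
    · have := card_inversions_mul_simpleRefl_of_gt h
      omega

theorem exists_isReducedWord (w : Perm (Fin (n + 1))) : ∃ l : List (Fin n), IsReducedWord l w := by
  obtain ⟨l, h1, h2, h3⟩ := exists_word_genLength closure_simpleRefl w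
  have : ∃ l' : List (Fin n), l'.map simpleRefl = l := by
    clear h2 h3
    induction l with
    | nil => exact ⟨[], rfl⟩
    | cons y l ih =>
      obtain ⟨l', hl'⟩ := ih fun z hz => h1 z (List.mem_cons_of_mem _ hz)
      obtain ⟨i, hi⟩ := h1 y List.mem_cons_self
      exact ⟨i :: l', by simp [hl', hi]⟩
  obtain ⟨l', rfl⟩ := this
  exact ⟨l', h2, by rw [lenS, ← h3, List.length_map]⟩

theorem lenS_wordProd_le (l : List (Fin n)) : lenS (wordProd l) ≤ l.length := by
  rw [← List.length_map (f := simpleRefl) (as := l)]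
  refine genLength_le fun y hy => ?_
  obtain ⟨s, -, rfl⟩ := List.mem_map.1 hy
  exact ⟨s, rfl⟩

theorem lenS_mul_le (x y : Perm (Fin (n + 1))) : lenS (x * y) ≤ lenS x + lenS y :=
  genLength_mul_le closure_simpleRefl x y

theorem lenS_simpleRefl_le (i : Fin n) : lenS (simpleRefl i) ≤ 1 :=
  genLength_mem_le ⟨i, rfl⟩

theorem lenS_eq_card_inversions (w : Perm (Fin (n + 1))) : lenS w = (inversions w).card := by
  refine le_antisymm ?_ ?_
  · have key : ∀ (k : ℕ) (w : Perm (Fin (n + 1))), (inversions w).card = k → lenS w ≤ k := by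
      intro k
      induction k with
      | zero =>
        intro w hw
        have hw' : w = 1 := by
          have h1 : StrictMono w := by
            rw [Fin.strictMono_iff_lt_succ]
            intro i
            refine lt_of_le_of_ne (not_lt.1 fun h => ?_) (w.injective.ne i.castSucc_lt_succ.ne)
            have := card_inversions_mul_simpleRefl_of_gt h
            omega
          have h2 : StrictMono (id : Fin (n + 1) → Fin (n + 1)) := strictMono_id
          exact Equiv.ext fun i => congrFun ((h1.range_inj h2).1 (by simp)) i
        rw [hw']
        exact (genLength_one).le
      | succ k ih =>
        intro w hw
        have hne : ∃ i : Fin n, w i.succ < w i.castSucc := by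
          by_contra! h
          have h1 : StrictMono w := by
            rw [Fin.strictMono_iff_lt_succ]
            exact fun i => lt_of_le_of_ne (h i) (w.injective.ne i.castSucc_lt_succ.ne)
          have : (inversions w) = ∅ := by
            rw [Finset.eq_empty_iff_forall_notMem]
            intro p hp
            exact absurd (h1 (mem_inversions.1 hp).1) (mem_inversions.1 hp).2.asymm
          simp [this] at hw
        obtain ⟨i, hi⟩ := hne
        have h1 := card_inversions_mul_simpleRefl_of_gt hi
        have h2 := ih (w * simpleRefl i) (by omega)
        have h3 := lenS_mul_le (w * simpleRefl i) (simpleRefl i)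
        have h4 := lenS_simpleRefl_le i
        rw [mul_assoc, simpleRefl_mul_self, mul_one] at h3
        omega
    exact key _ w rfl
  · obtain ⟨l, rfl, h2⟩ := exists_isReducedWord w
    rw [← h2]
    exact card_inversions_wordProd_le l

theorem lenS_mul_simpleRefl_of_gt {w : Perm (Fin (n + 1))} {i : Fin n}
    (h : w i.succ < w i.castSucc) : lenS (w * simpleRefl i) + 1 = lenS w := by
  rw [lenS_eq_card_inversions, lenS_eq_card_inversions, card_inversions_mul_simpleRefl_of_gt h]

theorem mem_rightDescents {w : Perm (Fin (n + 1))} {i : Fin n} :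
    i ∈ rightDescents w ↔ w i.succ < w i.castSucc := by
  rw [rightDescents, Finset.mem_filter]
  refine ⟨fun h => ?_, fun h => ⟨Finset.mem_univ i, by have := lenS_mul_simpleRefl_of_gt h; omega⟩⟩
  by_contra h'
  have := card_inversions_mul_simpleRefl
    (lt_of_le_of_ne (not_lt.1 h') (w.injective.ne i.castSucc_lt_succ.ne))
  rw [← lenS_eq_card_inversions, ← lenS_eq_card_inversions] at this
  omega

theorem lenS_inv_le (w : Perm (Fin (n + 1))) : lenS w⁻¹ ≤ lenS w := by
  obtain ⟨l, rfl, h2⟩ := exists_isReducedWord w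
  rw [← h2, ← List.length_reverse]
  have : (wordProd l)⁻¹ = wordProd l.reverse := by
    clear h2
    induction l with
    | nil => simp [wordProd]
    | cons i l ih =>
      rw [wordProd_cons, mul_inv_rev, ih, List.reverse_cons, wordProd_append, simpleRefl_inv]
      simp [wordProd]
  rw [this]
  exact lenS_wordProd_le _

theorem lenS_inv (w : Perm (Fin (n + 1))) : lenS w⁻¹ = lenS w :=
  le_antisymm (lenS_inv_le w) (by simpa using lenS_inv_le w⁻¹)

theorem leftDescents_eq (w : Perm (Fin (n + 1))) : leftDescents w = rightDescents w⁻¹ := by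
  ext i
  rw [leftDescents, rightDescents, Finset.mem_filter, Finset.mem_filter, ← lenS_inv w,
    ← lenS_inv (simpleRefl i * w), mul_inv_rev, simpleRefl_inv]

/- ### Fully commutative permutations -/

theorem CommMove.perm {l l' : List (Fin n)} (h : CommMove l l') : l.Perm l' := by
  obtain ⟨u, v, i, j, -⟩ := h
  exact (List.Perm.swap j i v).append_left u

/-- Commutations preserve the multiset of letters, so two reduced words with different multisets
refute full commutativity. -/
theorem IsFullyCommutative.perm {w : Perm (Fin (n + 1))} (hw : IsFullyCommutative w)
    {l l' : List (Fin n)} (hl : IsReducedWord l w) (hl' : IsReducedWord l' w) : l.Perm l' := by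
  have := hw l l' hl hl'
  clear hl hl'
  induction this with
  | refl => exact List.Perm.refl _
  | tail _ h ih => exact ih.trans h.perm

/-- Permutations without decreasing subsequences of length three. -/
def Avoids321 (w : Perm (Fin (n + 1))) : Prop :=
  ∀ a b c, a < b → b < c → w b < w a → ¬ w c < w b

theorem Avoids321.inv {w : Perm (Fin (n + 1))} (hw : Avoids321 w) : Avoids321 w⁻¹ := by
  intro a b c hab hbc h1 h2
  exact hw _ _ _ h2 h1 (by simpa using hbc) (by simpa using hab)

theorem wordProd_singleton (i : Fin n) : wordProd [i] = simpleRefl i := by simp [wordProd]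

theorem exists_not_perm_of_mul {w : Perm (Fin (n + 1))} {i : Fin n} (hi : w i.succ < w i.castSucc)
    (h : ∃ l l', IsReducedWord l (w * simpleRefl i) ∧ IsReducedWord l' (w * simpleRefl i) ∧
      ¬ l.Perm l') : ∃ l l', IsReducedWord l w ∧ IsReducedWord l' w ∧ ¬ l.Perm l' := by
  have h1 := lenS_mul_simpleRefl_of_gt hi
  have key : ∀ l, IsReducedWord l (w * simpleRefl i) → IsReducedWord (l ++ [i]) w := by
    rintro l ⟨h2, h3⟩
    refine ⟨?_, by rw [List.length_append, List.length_singleton, h3, h1]⟩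
    rw [wordProd_append, wordProd_singleton, h2, mul_assoc, simpleRefl_mul_self, mul_one]
  obtain ⟨l, l', h2, h3, h4⟩ := h
  exact ⟨_, _, key l h2, key l' h3, fun h => h4 ((List.perm_append_right_iff _).1 h)⟩

theorem simpleRefl_braid {i j : Fin n} (hij : (i : ℕ) + 1 = j) :
    simpleRefl i * simpleRefl j * simpleRefl i = simpleRefl j * simpleRefl i * simpleRefl j := by
  have hj : j.castSucc = i.succ := Fin.ext (by simp; omega)
  have h1 : i.castSucc ≠ i.succ := i.castSucc_lt_succ.ne
  have h2 : j.castSucc ≠ j.succ := j.castSucc_lt_succ.ne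
  have h3 : i.castSucc ≠ j.succ := fun h => by
    have := congrArg Fin.val h
    simp only [Fin.val_castSucc, Fin.val_succ] at this
    omega
  rw [hj] at h2
  have e1 := swap_mul_swap_mul_swap h1 h3
  have e2 := swap_mul_swap_mul_swap h2.symm h3.symm
  rw [swap_comm i.succ i.castSucc, swap_comm j.succ i.succ, swap_comm i.castSucc j.succ] at e2
  rw [simpleRefl, simpleRefl, hj, e1, e2]

theorem simpleRefl_mul_cancel_left (i : Fin n) (x : Perm (Fin (n + 1))) :
    simpleRefl i * (simpleRefl i * x) = x := by
  rw [← mul_assoc, simpleRefl_mul_self, one_mul]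

/-- Descents at two adjacent places allow `w = u s_i s_j s_i = u s_j s_i s_j` with three letters
split off reducedly. The two words contain `i` a different number of times. -/
theorem exists_not_perm_of_consecutive {w : Perm (Fin (n + 1))} {i j : Fin n}
    (hij : (i : ℕ) + 1 = j) (h1 : w i.succ < w i.castSucc) (h2 : w j.succ < w j.castSucc) :
    ∃ l l', IsReducedWord l w ∧ IsReducedWord l' w ∧ ¬ l.Perm l' := by
  have hj : j.castSucc = i.succ := Fin.ext (by simp; omega)
  have hij' : i ≠ j := by rintro rfl; omega
  have hj' : simpleRefl i j.succ = j.succ := Fin.ext (by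
    rw [simpleRefl_apply]; simp only [Fin.val_succ]; split_ifs <;> omega)
  have hi' : simpleRefl j i.castSucc = i.castSucc := Fin.ext (by
    rw [simpleRefl_apply]; simp only [Fin.val_castSucc]; split_ifs <;> omega)
  have e1 := lenS_mul_simpleRefl_of_gt h1
  have e2 := lenS_mul_simpleRefl_of_gt (w := w * simpleRefl i) (i := j) (by
    rw [Perm.mul_apply, Perm.mul_apply, hj', hj, simpleRefl_succ]
    rw [hj] at h2
    exact h2.trans h1)
  have e3 := lenS_mul_simpleRefl_of_gt (w := w * simpleRefl i * simpleRefl j) (i := i) (by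
    simp only [Perm.mul_apply]
    rw [hi', simpleRefl_castSucc, ← hj, simpleRefl_castSucc, hj', hj, ]
    rwa [hj] at h2)
  obtain ⟨l, h3, h4⟩ := exists_isReducedWord (w * simpleRefl i * simpleRefl j * simpleRefl i)
  refine ⟨l ++ [i, j, i], l ++ [j, i, j], ⟨?_, ?_⟩, ⟨?_, ?_⟩, fun h => ?_⟩
  · rw [wordProd_append, h3]
    have : wordProd [i, j, i] = simpleRefl i * simpleRefl j * simpleRefl i := by
      simp [wordProd, mul_assoc]
    rw [this]
    simp only [mul_assoc, simpleRefl_mul_cancel_left, simpleRefl_mul_self, mul_one]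
  · rw [List.length_append, h4]
    simp only [List.length_cons, List.length_nil]
    omega
  · rw [wordProd_append, h3]
    have : wordProd [j, i, j] = simpleRefl i * simpleRefl j * simpleRefl i := by
      rw [simpleRefl_braid hij]
      simp [wordProd, mul_assoc]
    rw [this]
    simp only [mul_assoc, simpleRefl_mul_cancel_left, simpleRefl_mul_self, mul_one]
  · rw [List.length_append, h4]
    simp only [List.length_cons, List.length_nil]
    omega
  · have := ((List.perm_append_left_iff _).1 h).count_eq i
    simp [hij', hij'.symm] at this

/-- Induction on the width `c - a` of a 321 pattern. If there is a gap, compare the value at the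
point next to the outer end, inside the gap, with the middle value `w b`: either that point replaces
the outer end, or there is a descent at the outer end, and removing it from `w` narrows the pattern.
Without gaps, the descents are adjacent. -/
theorem exists_not_perm {w : Perm (Fin (n + 1))} {a b c : Fin (n + 1)} (hab : a < b) (hbc : b < c)
    (h1 : w b < w a) (h2 : w c < w b) :
    ∃ l l', IsReducedWord l w ∧ IsReducedWord l' w ∧ ¬ l.Perm l' := by
  have key : ∀ (d : ℕ) (w : Perm (Fin (n + 1))) (a b c : Fin (n + 1)), (c : ℕ) - a = d → a < b →
      b < c → w b < w a → w c < w b →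
      ∃ l l', IsReducedWord l w ∧ IsReducedWord l' w ∧ ¬ l.Perm l' := by
    intro d
    induction d using Nat.strong_induction_on with
    | _ d ih =>
      intro w a b c hd hab hbc h1 h2
      have hc := c.2
      have hab' := Fin.lt_def.1 hab
      have hbc' := Fin.lt_def.1 hbc
      by_cases hab1 : (a : ℕ) + 1 = b
      · by_cases hbc1 : (b : ℕ) + 1 = c
        · have ha : (⟨a, by omega⟩ : Fin n).castSucc = a := rfl
          have hb : (⟨a, by omega⟩ : Fin n).succ = b := Fin.ext hab1
          have hb' : (⟨b, by omega⟩ : Fin n).castSucc = b := rfl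
          have hc' : (⟨b, by omega⟩ : Fin n).succ = c := Fin.ext hbc1
          exact exists_not_perm_of_consecutive (i := ⟨a, by omega⟩) (j := ⟨b, by omega⟩) hab1
            (by rwa [ha, hb]) (by rwa [hb', hc'])
        · let i : Fin n := ⟨c - 1, by omega⟩
          have hi : i.succ = c := Fin.ext (by simp [i]; omega)
          have hi1 : (i.castSucc : ℕ) = c - 1 := rfl
          have hib : b < i.castSucc := Fin.lt_def.2 (by omega)
          have hic : i.castSucc < c := Fin.lt_def.2 (by omega)
          rcases lt_or_gt_of_ne (w.injective.ne hib.ne) with h3 | h3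
          · have hb1 : simpleRefl i b = b := swap_apply_of_ne_of_ne hib.ne (by rw [hi]; exact hbc.ne)
            have ha1 : simpleRefl i a = a := swap_apply_of_ne_of_ne (hab.trans hib).ne
              (by rw [hi]; exact (hab.trans hbc).ne)
            refine exists_not_perm_of_mul (i := i) (by rw [hi]; exact h2.trans h3)
              (ih _ ?_ _ a b i.castSucc rfl hab hib ?_ ?_)
            · omega
            · rwa [Perm.mul_apply, Perm.mul_apply, ha1, hb1]
            · rwa [Perm.mul_apply, Perm.mul_apply, hb1, simpleRefl_castSucc, hi]
          · exact ih _ (by omega) w a b i.castSucc rfl hab hib h1 h3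
      · let i : Fin n := ⟨a, by omega⟩
        have hi : i.castSucc = a := rfl
        have hi1 : (i.succ : ℕ) = a + 1 := rfl
        have hib : i.succ < b := Fin.lt_def.2 (by omega)
        have hia : a < i.succ := Fin.lt_def.2 (by omega)
        rcases lt_or_gt_of_ne (w.injective.ne hib.ne) with h3 | h3
        · have hb1 : simpleRefl i b = b := swap_apply_of_ne_of_ne hab.ne' hib.ne'
          have hc1 : simpleRefl i c = c := swap_apply_of_ne_of_ne (hab.trans hbc).ne'
            (hib.trans hbc).ne'
          refine exists_not_perm_of_mul (i := i) (by rw [hi]; exact h3.trans h1)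
            (ih _ ?_ _ i.succ b c rfl hib hbc ?_ ?_)
          · omega
          · rwa [Perm.mul_apply, Perm.mul_apply, simpleRefl_succ, hb1]
          · rwa [Perm.mul_apply, Perm.mul_apply, hb1, hc1]
        · exact ih _ (by omega) w i.succ b c rfl hib hbc h3 h2
  exact key _ w a b c rfl hab hbc h1 h2

theorem IsFullyCommutative.avoids321 {w : Perm (Fin (n + 1))} (hw : IsFullyCommutative w) :
    Avoids321 w := by
  intro a b c hab hbc h1 h2
  obtain ⟨l, l', hl, hl', h⟩ := exists_not_perm hab hbc h1 h2
  exact h (hw.perm hl hl')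

/-- Everything left of the descent, together with `i + 1`, has a value below `w i`, since a larger
value on the left would complete a 321 pattern. Counting gives `w i > i`; the other half is dual. -/
theorem Avoids321.descent {w : Perm (Fin (n + 1))} (hw : Avoids321 w) {i : Fin n}
    (hi : w i.succ < w i.castSucc) : i.castSucc < w i.castSucc ∧ w i.succ < i.succ := by
  have h0 := i.castSucc_lt_succ
  constructor
  · have key : (insert i.succ (Finset.Iio i.castSucc)).card ≤ (Finset.Iio (w i.castSucc)).card := by
      refine Finset.card_le_card_of_injOn w (fun k hk => ?_) w.injective.injOn
      rw [Finset.coe_Iio, Set.mem_Iio]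
      rcases Finset.mem_insert.1 (Finset.mem_coe.1 hk) with rfl | hk
      · exact hi
      · rw [Finset.mem_Iio] at hk
        exact lt_of_le_of_ne (not_lt.1 fun h => hw k _ _ hk h0 h hi) (w.injective.ne hk.ne)
    rw [Finset.card_insert_of_notMem (by simpa using h0.le), Fin.card_Iio, Fin.card_Iio] at key
    exact Fin.lt_def.2 key
  · have key : (insert i.castSucc (Finset.Ioi i.succ)).card ≤ (Finset.Ioi (w i.succ)).card := by
      refine Finset.card_le_card_of_injOn w (fun k hk => ?_) w.injective.injOn
      rw [Finset.coe_Ioi, Set.mem_Ioi]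
      rcases Finset.mem_insert.1 (Finset.mem_coe.1 hk) with rfl | hk
      · exact hi
      · rw [Finset.mem_Ioi] at hk
        exact lt_of_le_of_ne (not_lt.1 fun h => hw _ _ k h0 hk hi h) (w.injective.ne hk.ne)
    rw [Finset.card_insert_of_notMem (by simpa using h0.le), Fin.card_Ioi, Fin.card_Ioi] at key
    have h1 := (w i.succ).2
    have h2 := i.2
    rw [Fin.lt_def]
    rw [Fin.val_succ] at key ⊢
    omega

/- ### Canonical forms -/

theorem descRun_self (i : Fin n) : descRun i i = [i] := by
  have hs := List.pairwise_lt_finRange n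
  rw [descRun, List.reverse_eq_iff]
  refine List.Perm.eq_of_pairwise (le := (· < ·)) (fun x y _ _ h h' => absurd h h'.asymm)
    (hs.filter _) (by simp) ?_
  rw [List.perm_ext_iff_of_nodup ((List.nodup_finRange n).filter _) (by simp)]
  intro x
  simpa using le_antisymm_iff.symm.trans eq_comm

theorem descRun_eq_append {i j j' : Fin n} (hj : (j : ℕ) + 1 = j') (hi : j' ≤ i) :
    descRun i j = descRun i j' ++ [j] := by
  have hs := List.pairwise_lt_finRange n
  rw [descRun, descRun, List.reverse_eq_iff, List.reverse_append, List.reverse_reverse,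
    List.reverse_singleton, List.singleton_append]
  refine List.Perm.eq_of_pairwise (le := (· < ·)) (fun x y _ _ h h' => absurd h h'.asymm)
    (hs.filter _) ?_ ?_
  · rw [List.pairwise_cons]
    refine ⟨fun x hx => ?_, hs.filter _⟩
    simp only [List.mem_filter, List.mem_finRange, true_and, decide_eq_true_eq, Fin.le_def] at hx
    rw [Fin.lt_def]
    omega
  · rw [List.perm_ext_iff_of_nodup ((List.nodup_finRange n).filter _)]
    · intro x
      simp only [List.mem_filter, List.mem_finRange, true_and, decide_eq_true_eq, List.mem_cons,
        Fin.le_def, Fin.ext_iff] at *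
      omega
    · rw [List.nodup_cons]
      refine ⟨fun h => ?_, (List.nodup_finRange n).filter _⟩
      simp only [List.mem_filter, List.mem_finRange, true_and, decide_eq_true_eq, Fin.le_def] at h
      omega

/-- Induction on the length of a descending run. -/
theorem descRun_induction {i : Fin n} {P : Fin n → Prop} (base : P i)
    (step : ∀ j j' : Fin n, (j : ℕ) + 1 = j' → j' ≤ i → P j' → P j) (j : Fin n) (hj : j ≤ i) :
    P j := by
  have key : ∀ (d : ℕ) (j : Fin n), (j : ℕ) + d = i → P j := by
    intro d
    induction d with
    | zero =>
      intro j hj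
      rwa [Fin.ext (show (j : ℕ) = i from hj)]
    | succ d ih =>
      intro j hj
      have h1 := i.2
      exact step j ⟨j + 1, by omega⟩ rfl (Fin.le_def.2 (by simp only; omega))
        (ih _ (by simp only; omega))
  exact key (i - j) j (by have := Fin.le_def.1 hj; omega)

theorem wordProd_descRun_apply {i j : Fin n} (hj : j ≤ i) (k : Fin (n + 1)) :
    (wordProd (descRun i j) k : ℕ) =
      if (k : ℕ) = j then (i : ℕ) + 1
      else if (j : ℕ) < k ∧ (k : ℕ) ≤ i + 1 then (k : ℕ) - 1 else k := by
  revert k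
  refine descRun_induction (P := fun j => ∀ k : Fin (n + 1), (wordProd (descRun i j) k : ℕ) =
      if (k : ℕ) = j then (i : ℕ) + 1
      else if (j : ℕ) < k ∧ (k : ℕ) ≤ i + 1 then (k : ℕ) - 1 else k) ?_ ?_ j hj
  · intro k
    rw [descRun_self, wordProd_singleton, simpleRefl_apply]
    split_ifs <;> omega
  · intro j j' hjj' hji ih k
    rw [descRun_eq_append hjj' hji, wordProd_append, wordProd_singleton, Perm.mul_apply, ih,
      simpleRefl_apply]
    have := Fin.le_def.1 hji
    split_ifs <;> omega

/-- The run `s_i ⋯ s_j` sends `j` to `i + 1` and lowers `j + 1, …, i + 1` by one. Since the indices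
increase, the later runs do not touch `j`, and the earlier runs do not touch the value `i + 1`. So
the excedances are exactly the pairs `j ↦ i + 1`. The third clause serves the induction. -/
theorem canonicalForm_apply {l : List (Fin n × Fin n)}
    (hl : l.Pairwise (fun p q => p.1 < q.1 ∧ p.2 < q.2)) (hl' : ∀ p ∈ l, p.2 ≤ p.1) :
    (∀ p ∈ l, wordProd (l.flatMap fun p => descRun p.1 p.2) p.2.castSucc = p.1.succ) ∧
      (∀ k, (∀ p ∈ l, p.2.castSucc ≠ k) → wordProd (l.flatMap fun p => descRun p.1 p.2) k ≤ k) ∧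
      (∀ k, (∀ p ∈ l, k < p.2.castSucc) →
        wordProd (l.flatMap fun p => descRun p.1 p.2) k = k) := by
  induction l with
  | nil => simp [wordProd]
  | cons p l ih =>
    obtain ⟨h1, h2, h3⟩ := ih (List.pairwise_cons.1 hl).2
      fun q hq => hl' q (List.mem_cons_of_mem _ hq)
    have hp := (List.pairwise_cons.1 hl).1
    have hp' := hl' p (by simp)
    have h4 := wordProd_descRun_apply hp'
    have h5 := h3 p.2.castSucc fun q hq => by simpa using (hp q hq).2
    rw [List.flatMap_cons, wordProd_append]
    set y := wordProd (l.flatMap fun p => descRun p.1 p.2)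
    clear_value y
    refine ⟨fun q hq => ?_, fun k hk => ?_, fun k hk => ?_⟩
    · rw [Perm.mul_apply]
      rcases List.mem_cons.1 hq with rfl | hq
      · rw [h5, Fin.ext_iff, h4, if_pos (Fin.val_castSucc _), Fin.val_succ]
      · have h6 := Fin.lt_def.1 (hp q hq).1
        have h7 := Fin.le_def.1 hp'
        rw [h1 q hq, Fin.ext_iff, h4, Fin.val_succ, if_neg (by omega), if_neg (by omega)]
    · have h6 := Fin.le_def.1 (h2 k fun q hq => hk q (List.mem_cons_of_mem _ hq))
      have h7 : y k ≠ p.2.castSucc := fun h => by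
        rw [← h5] at h
        exact hk p (by simp) (y.injective h).symm
      have h8 : (y k : ℕ) ≠ p.2 := fun h => h7 (Fin.ext h)
      rw [Perm.mul_apply, Fin.le_def, h4, if_neg h8]
      split_ifs <;> omega
    · have h6 : (k : ℕ) < p.2 := Fin.lt_def.1 (hk p (by simp))
      rw [Perm.mul_apply, h3 k fun q hq => hk q (List.mem_cons_of_mem _ hq), Fin.ext_iff, h4,
        if_neg (by omega), if_neg (by omega)]

theorem IsCanonicalForm.image_snd {l : List (Fin n × Fin n)} {w : Perm (Fin (n + 1))}
    (h : IsCanonicalForm l w) (j : Fin n) : (∃ p ∈ l, p.2 = j) ↔ j.castSucc < w j.castSucc := by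
  obtain ⟨h1, h2, h3, -⟩ := h
  obtain ⟨h4, h5, -⟩ := canonicalForm_apply h1 h2
  rw [h3] at h4 h5
  constructor
  · rintro ⟨p, hp, rfl⟩
    rw [h4 p hp, Fin.castSucc_lt_succ_iff]
    exact h2 p hp
  · intro h
    by_contra! h'
    exact absurd h (not_lt.2 (h5 _ fun p hp hpj => h' p hp (by simpa using hpj)))

theorem IsCanonicalForm.image_fst {l : List (Fin n × Fin n)} {w : Perm (Fin (n + 1))}
    (h : IsCanonicalForm l w) (i : Fin n) : (∃ p ∈ l, p.1 = i) ↔ w⁻¹ i.succ < i.succ := by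
  obtain ⟨h1, h2, h3, -⟩ := h
  obtain ⟨h4, h5, -⟩ := canonicalForm_apply h1 h2
  rw [h3] at h4 h5
  constructor
  · rintro ⟨p, hp, rfl⟩
    rw [Perm.inv_eq_iff_eq.2 (h4 p hp).symm, Fin.castSucc_lt_succ_iff]
    exact h2 p hp
  · intro h
    by_contra! h'
    have hwi : w (w⁻¹ i.succ) = i.succ := by simp
    have := h5 (w⁻¹ i.succ) fun p hp hpi => h' p hp (by
      have := h4 p hp
      rw [hpi, hwi] at this
      exact (Fin.succ_injective _ this).symm)
    rw [hwi] at this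
    exact absurd h (not_lt.2 this)

theorem lenS_eq_add_descRun {i j : Fin n} (hj : j ≤ i) {w : Perm (Fin (n + 1))}
    (h : ∀ k : Fin (n + 1), j.castSucc < k → k ≤ i.succ → w k < w j.castSucc) :
    lenS w = lenS (w * (wordProd (descRun i j))⁻¹) + (descRun i j).length := by
  revert w
  refine descRun_induction (P := fun j => ∀ {w : Perm (Fin (n + 1))},
    (∀ k : Fin (n + 1), j.castSucc < k → k ≤ i.succ → w k < w j.castSucc) →
      lenS w = lenS (w * (wordProd (descRun i j))⁻¹) + (descRun i j).length) ?_ ?_ j hj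
  · intro w h
    rw [descRun_self, wordProd_singleton, simpleRefl_inv, List.length_singleton,
      lenS_mul_simpleRefl_of_gt (h _ i.castSucc_lt_succ le_rfl)]
  · intro j j' hjj' hji ih w h
    have h1 : j.succ = j'.castSucc := Fin.ext (by simpa using hjj')
    have h2 : j'.castSucc ≤ i.succ := (Fin.castSucc_le_castSucc_iff.2 hji).trans i.castSucc_lt_succ.le
    rw [descRun_eq_append hjj' hji, wordProd_append, wordProd_singleton, List.length_append,
      List.length_singleton, mul_inv_rev, simpleRefl_inv, ← mul_assoc, ← add_assoc, ← ih,
      lenS_mul_simpleRefl_of_gt (h _ j.castSucc_lt_succ (h1 ▸ h2))]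
    intro k hk hk'
    have hk1 : j.castSucc < k := (Fin.lt_def.2 (by simp; omega)).trans hk
    rw [Perm.mul_apply, Perm.mul_apply, ← h1, simpleRefl_succ, simpleRefl,
      swap_apply_of_ne_of_ne hk1.ne' (by rw [h1]; exact hk.ne')]
    exact h k hk1 hk'

/-- Induction on the largest value `m` that may move. If `p` is its position, the last run is
`s_{m-1} ⋯ s_p`. Removing it shortens `w` by the length of the run, fixes `m`, and keeps the order
of the remaining values, so 321 is still avoided. -/
theorem Avoids321.exists_isCanonicalForm {w : Perm (Fin (n + 1))} (hw : Avoids321 w) :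
    ∃ l, IsCanonicalForm l w := by
  have key : ∀ N ≤ n + 1, ∀ w : Perm (Fin (n + 1)), Avoids321 w →
      (∀ k : Fin (n + 1), N ≤ k → w k = k) →
      ∃ l, IsCanonicalForm l w ∧ ∀ p ∈ l, (p.1 : ℕ) + 1 < N := by
    intro N
    induction N with
    | zero =>
      intro _ w _ hfix
      have : w = 1 := Equiv.ext fun k => hfix k (Nat.zero_le _)
      refine ⟨[], ⟨by simp, by simp, ?_, ?_⟩, by simp⟩
      · simp [this, wordProd]
      · simp [this, lenS, genLength_one]
    | succ N ih =>
      intro hN w hw hfix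
      obtain ⟨m, rfl⟩ : ∃ m : Fin (n + 1), (m : ℕ) = N := ⟨⟨N, hN⟩, rfl⟩
      by_cases hm : w m = m
      · obtain ⟨l, h1, h2⟩ := ih (by omega) w hw (fun k hk => by
          rcases hk.eq_or_lt with hk | hk
          · rwa [← Fin.ext hk]
          · exact hfix k hk)
        exact ⟨l, h1, fun p hp => (h2 p hp).trans (Nat.lt_succ_self _)⟩
      obtain ⟨p, hp⟩ := w.surjective m
      have hpm : p < m := by
        refine lt_of_le_of_ne (not_lt.1 fun h' => ?_) fun h' => hm (by rwa [h'] at hp)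
        exact h'.ne ((hfix p h').symm.trans hp).symm
      have hpm' := Fin.lt_def.1 hpm
      have hle : ∀ k : Fin (n + 1), k ≤ m → w k ≤ m := by
        intro k hk
        by_contra! h
        have := w.injective (hfix (w k) h)
        rw [this] at h
        exact absurd hk (not_le.2 h)
      have hmn := m.2
      let i : Fin n := ⟨m - 1, by omega⟩
      let j : Fin n := ⟨p, by omega⟩
      have hji : j ≤ i := Fin.le_def.2 (by simp only [i, j]; omega)
      have hi : i.succ = m := Fin.ext (by simp only [i, Fin.val_succ]; omega)
      have hj : j.castSucc = p := rfl
      set r := wordProd (descRun i j) with hr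
      have hrk := wordProd_descRun_apply hji
      rw [← hr] at hrk
      have hiv : (i : ℕ) + 1 = m := by simp only [i]; omega
      have hjv : (j : ℕ) = p := rfl
      rw [hiv, hjv] at hrk
      have hrp : r p = m := Fin.ext (by rw [hrk, if_pos rfl])
      have hlen := lenS_eq_add_descRun hji (w := w) (fun k h1 h2 => by
        rw [hj] at h1
        rw [hj, hp]
        rw [hi] at h2
        exact lt_of_le_of_ne (hle k h2) fun h => h1.ne' (w.injective (h.trans hp.symm)))
      rw [← hr] at hlen
      set w' := w * r⁻¹ with hw'
      have hw'r : ∀ k, w' (r k) = w k := fun k => by simp [hw']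
      have hw'm : w' m = m := by rw [← hrp, hw'r, hp, hrp]
      have hw'fix : ∀ k : Fin (n + 1), (m : ℕ) ≤ k → w' k = k := by
        intro k hk
        rcases hk.eq_or_lt with hk | hk
        · rwa [← Fin.ext hk]
        · have : r k = k := Fin.ext (by rw [hrk, if_neg (by omega), if_neg (by omega)])
          conv_lhs => rw [← this]
          rw [hw'r, hfix k hk]
      have havoid : Avoids321 w' := by
        intro a b c hab hbc h1 h2
        obtain ⟨a, rfl⟩ := r.surjective a
        obtain ⟨b, rfl⟩ := r.surjective b
        obtain ⟨c, rfl⟩ := r.surjective c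
        rw [hw'r, hw'r] at h1 h2
        have hne : ∀ k : Fin (n + 1), k ≠ p → (k : ℕ) ≠ p := fun k => val_ne
        have hgt : ∀ k : Fin (n + 1), m < r k → m < w k := fun k hk => by
          have h3 := hrk k
          have h4 := Fin.lt_def.1 hk
          have h5 : m < k := Fin.lt_def.2 (by split_ifs at h3 <;> omega)
          rwa [hfix k h5]
        have hbp : b ≠ p := by
          rintro rfl
          rw [hrp] at hbc
          rw [hp] at h2
          exact (hgt c hbc).asymm h2
        have hap : a ≠ p := by
          rintro rfl
          rw [hrp] at hab
          rw [hp] at h1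
          exact (hgt b hab).asymm h1
        have hcp : c ≠ p := by
          rintro rfl
          rw [hp] at h2
          rw [hrp] at hbc
          have h3 := hrk b
          have h4 := Fin.lt_def.1 hbc
          exact absurd h2 (not_lt.2 (hle b (Fin.le_def.2 (by split_ifs at h3 <;> omega))))
        have h3 := hrk a
        have h4 := hrk b
        have h5 := hrk c
        have h6 := Fin.lt_def.1 hab
        have h7 := Fin.lt_def.1 hbc
        rw [if_neg (hne _ hap)] at h3
        rw [if_neg (hne _ hbp)] at h4
        rw [if_neg (hne _ hcp)] at h5
        have h8 := hne _ hap
        have h9 := hne _ hbp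
        have h10 := hne _ hcp
        refine hw a b c (Fin.lt_def.2 ?_) (Fin.lt_def.2 ?_) h1 h2
        · split_ifs at h3 h4 <;> omega
        · split_ifs at h4 h5 <;> omega
      obtain ⟨l, ⟨h1, h2, h3, h4⟩, h5⟩ := ih (by omega) w' havoid hw'fix
      refine ⟨l ++ [(i, j)], ⟨?_, ?_, ?_, ?_⟩, ?_⟩
      · rw [List.pairwise_append]
        refine ⟨h1, by simp, fun q hq q' hq' => ?_⟩
        rw [List.mem_singleton.1 hq']
        have h6 := h5 q hq
        refine ⟨Fin.lt_def.2 (by simp only [i]; omega), ?_⟩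
        have h7 := (canonicalForm_apply h1 h2).1 q hq
        rw [h3] at h7
        by_contra h8
        have h8 : (p : ℕ) ≤ q.2 := Fin.le_def.1 (not_lt.1 h8)
        have h9 := Fin.le_def.1 (h2 q hq)
        have h10 : r q.2.succ = q.2.castSucc := Fin.ext (by
          rw [hrk, Fin.val_succ, Fin.val_castSucc, if_neg (by omega), if_pos (by omega)]
          omega)
        rw [← h10, hw'r] at h7
        have hpq : p < q.2.succ := Fin.lt_def.2 (by rw [Fin.val_succ]; omega)
        have hqm : q.1.succ < m := Fin.lt_def.2 (by rw [Fin.val_succ]; omega)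
        -- Suppose an earlier run had its lower index at or above `p`. Then `w p = m` and `w (q.2 +
        -- 1) = q.1 + 1` form a descending pair, and 321-avoidance puts all values up to `q.1 + 1`
        -- at positions up to `q.2 + 1` other than `p`. There are too few of these because `q.2 ≤
        -- q.1`.
        have key : (Finset.Iic q.1.succ).card ≤ ((Finset.Iic q.2.succ).erase p).card := by
          refine Finset.card_le_card_of_injOn (⇑w⁻¹) (fun v hv => ?_) w⁻¹.injective.injOn
          rw [Finset.coe_Iic, Set.mem_Iic] at hv
          obtain ⟨k, rfl⟩ := w.surjective v
          have hk : w⁻¹ (w k) = k := by simp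
          rw [hk, Finset.mem_coe, Finset.mem_erase, Finset.mem_Iic]
          refine ⟨?_, ?_⟩
          · rintro rfl
            rw [hp] at hv
            exact absurd hqm (not_lt.2 hv)
          · by_contra! h11
            refine hw p _ k hpq h11 (by rwa [h7, hp]) (lt_of_le_of_ne (by rwa [h7]) ?_)
            exact w.injective.ne h11.ne'
        rw [Finset.card_erase_of_mem (Finset.mem_Iic.2 hpq.le), Fin.card_Iic, Fin.card_Iic,
          Fin.val_succ, Fin.val_succ] at key
        omega
      · intro q hq
        rcases List.mem_append.1 hq with hq | hq
        · exact h2 q hq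
        · rw [List.mem_singleton.1 hq]
          exact hji
      · rw [List.flatMap_append, wordProd_append, h3]
        simp [hw', ← hr]
      · rw [List.flatMap_append, List.length_append, h4, hlen]
        simp
      · intro q hq
        rcases List.mem_append.1 hq with hq | hq
        · exact (h5 q hq).trans (Nat.lt_succ_self _)
        · rw [List.mem_singleton.1 hq]
          simp only [i]
          omega
  obtain ⟨l, h, -⟩ := key (n + 1) le_rfl w hw fun k hk => absurd k.2 (by omega)
  exact ⟨l, h⟩

/- ### The noncrossing permutation attached to a fully commutative permutation -/

theorem isNC_one : IsNC (1 : Perm (Fin (n + 1))) := fun _ _ => Iff.rfl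

theorem IsNC.apply_eq_of_not_lt {x : Perm (Fin (n + 1))} (hx : IsNC x) {m : Fin (n + 1)}
    (h1 : ¬ m < x m) (h2 : ¬ x⁻¹ m < m) : x m = m := by
  have h3 := (hx.Icc_iff (not_lt.1 h1) (x⁻¹ m)).2 (by simpa using not_lt.1 h1)
  have h4 : x⁻¹ m = m := le_antisymm h3.2 (not_lt.1 h2)
  exact (Perm.inv_eq_iff_eq.1 h4).symm

/-- Adding an arc over a fixed interval. -/
theorem IsNC.exists_insert_arc {x : Perm (Fin (n + 1))} (hx : IsNC x) {j u : Fin (n + 1)}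
    (hju : j < u) (hj : ¬ j < x j) (hu : ¬ x⁻¹ u < u)
    (hfix : ∀ k, j < k → k < u → x k = k) :
    ∃ y : Perm (Fin (n + 1)), IsNC y ∧ (∀ m, m < y m ↔ m < x m ∨ m = j) ∧
      ∀ m, y⁻¹ m < m ↔ x⁻¹ m < m ∨ m = u := by
  obtain ⟨p, rfl⟩ := x.surjective u
  have hp : x⁻¹ (x p) = p := by simp
  rw [hp, not_lt] at hu
  have hjp : j < p := hju.trans_le hu
  refine ⟨x * swap j p, hx.merge ?_ ?_ fun k => ?_, fun m => ?_, fun m => ?_⟩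
  · exact Or.inr ⟨not_lt.1 hj, Or.inl hjp⟩
  · unfold CycIoo
    simp only [Fin.lt_def, Fin.le_def] at *
    omega
  · have key : ∀ k : Fin (n + 1), CycIoo j (x p) k ↔ j < k ∧ k < x p := fun k => by
      unfold CycIoo
      simp only [Fin.lt_def] at *
      omega
    rw [key, key]
    constructor
    · intro h
      rwa [hfix k h.1 h.2]
    · intro h
      have := x.injective (hfix _ h.1 h.2)
      rwa [this] at h
  · rw [Perm.mul_apply]
    rcases eq_or_ne m j with rfl | hmj
    · simpa using hju
    rcases eq_or_ne m p with rfl | hmp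
    · rw [swap_apply_right]
      refine iff_of_false (not_lt.2 ((not_lt.1 hj).trans hjp.le)) ?_
      rintro (h | h)
      exacts [not_lt.2 hu h, hmj h]
    · rw [swap_apply_of_ne_of_ne hmj hmp]
      simp [hmj]
  · obtain ⟨k, rfl⟩ := x.surjective m
    have hk : x⁻¹ (x k) = k := by simp
    rw [mul_inv_rev, swap_inv, Perm.mul_apply, hk, x.apply_eq_iff_eq]
    rcases eq_or_ne k j with rfl | hkj
    · rw [swap_apply_left]
      refine iff_of_false (not_lt.2 ((not_lt.1 hj).trans hjp.le)) ?_
      rintro (h | h)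
      exacts [hj h, hjp.ne h]
    rcases eq_or_ne k p with rfl | hkp
    · simpa using hju
    · rw [swap_apply_of_ne_of_ne hkj hkp]
      simp [hkp]

/-- Matching of parentheses, with `J` the openings and `U` the closings; the inequality says that
each closing has an opening available strictly before it. -/
theorem exists_isNC_of_card_le (c : ℕ) : ∀ J U : Finset (Fin (n + 1)), J.card = c → U.card = c →
    (∀ k, (U.filter (· ≤ k)).card ≤ (J.filter (· < k)).card) →
    ∃ x : Perm (Fin (n + 1)), IsNC x ∧ (∀ m, m < x m ↔ m ∈ J) ∧ ∀ m, x⁻¹ m < m ↔ m ∈ U := by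
  induction c with
  | zero =>
    intro J U hJ hU _
    rw [Finset.card_eq_zero] at hJ hU
    exact ⟨1, isNC_one, by simp [hJ], by simp [hU]⟩
  | succ c ih =>
    intro J U hJ hU h
    have hUne : U.Nonempty := Finset.card_pos.1 (by omega)
    -- The first closing is matched with the last opening before it. No other opening or closing
    -- lies between the two, so the permutation built from the rest fixes that interval and the arc
    -- can be inserted.
    set u := U.min' hUne with hu
    have huU : u ∈ U := U.min'_mem hUne
    have hmin : ∀ k ∈ U, u ≤ k := fun k hk => U.min'_le k hk
    have hJne : (J.filter (· < u)).Nonempty := by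
      refine Finset.card_pos.1 (lt_of_lt_of_le (Finset.card_pos.2 ⟨u, ?_⟩) (h u))
      simp [huU]
    set j := (J.filter (· < u)).max' hJne with hj
    obtain ⟨hjJ, hju⟩ := Finset.mem_filter.1 ((J.filter (· < u)).max'_mem hJne)
    rw [← hj] at hjJ hju
    have hmax : ∀ k ∈ J, k < u → k ≤ j := fun k hk hku =>
      (J.filter (· < u)).le_max' k (Finset.mem_filter.2 ⟨hk, hku⟩)
    clear_value u j
    obtain ⟨x, h1, h2, h3⟩ := ih (J.erase j) (U.erase u)
      (by rw [Finset.card_erase_of_mem hjJ, hJ]; rfl)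
      (by rw [Finset.card_erase_of_mem huU, hU]; rfl) (fun k => by
        rcases lt_or_ge k u with hk | hk
        · have : (U.erase u).filter (· ≤ k) = ∅ := by
            rw [Finset.filter_eq_empty_iff]
            exact fun m hm hmk =>
              absurd (hmin m (Finset.mem_of_mem_erase hm)) (not_le.2 (lt_of_le_of_lt hmk hk))
          simp [this]
        · rw [Finset.filter_erase, Finset.filter_erase,
            Finset.card_erase_of_mem (s := U.filter (· ≤ k)) (Finset.mem_filter.2 ⟨huU, hk⟩),
            Finset.card_erase_of_mem (s := J.filter (· < k))
              (Finset.mem_filter.2 ⟨hjJ, hju.trans_le hk⟩)]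
          exact Nat.sub_le_sub_right (h k) 1)
    have hjU : ¬ j < x j := by simp [h2]
    have huJ : ¬ x⁻¹ u < u := fun h => Finset.notMem_erase u U ((h3 u).1 h)
    obtain ⟨y, h4, h5, h6⟩ := h1.exists_insert_arc hju hjU huJ fun k hjk hku =>
      h1.apply_eq_of_not_lt
        (fun hk => not_le.2 hjk (hmax k (Finset.mem_of_mem_erase ((h2 k).1 hk)) hku))
        (fun hk => not_le.2 hku (hmin k (Finset.mem_of_mem_erase ((h3 k).1 hk))))
    refine ⟨y, h4, fun m => ?_, fun m => ?_⟩
    · rw [h5, h2, Finset.mem_erase]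
      rcases eq_or_ne m j with rfl | hm <;> simp_all
    · rw [h6, h3, Finset.mem_erase]
      rcases eq_or_ne m u with rfl | hm <;> simp_all

/-- Every permutation has the excedances of a noncrossing permutation. -/
theorem exists_isNC_excedances (w : Perm (Fin (n + 1))) :
    ∃ x : Perm (Fin (n + 1)), IsNC x ∧ (∀ m, m < x m ↔ m < w m) ∧
      ∀ m, x⁻¹ m < m ↔ w⁻¹ m < m := by
  have key : ∀ k, w (w⁻¹ k) = k := fun k => by simp
  obtain ⟨x, h1, h2, h3⟩ := exists_isNC_of_card_le _ (Finset.univ.filter fun m => m < w m)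
    (Finset.univ.filter fun m => w⁻¹ m < m) rfl
    (Finset.card_bij' (fun m _ => w⁻¹ m) (fun m _ => w m) (by simp) (by simp) (by simp) (by simp))
    -- An excedance value at most `k` comes from an excedance position strictly below `k`.
    (fun k => Finset.card_le_card_of_injOn (⇑w⁻¹) (fun m hm => by
      simp only [Finset.coe_filter, Finset.mem_filter, Finset.mem_univ, true_and,
        Set.mem_ofPred_eq, key] at hm ⊢
      exact ⟨hm.1, hm.1.trans_le hm.2⟩) w⁻¹.injective.injOn)
  exact ⟨x, h1, by simpa using h2, by simpa using h3⟩

/-- This is all that is used about `ψ(w)`. The existence of a noncrossing permutation with the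
prescribed sets also rules out the default value `1` in its definition. -/
theorem IsFullyCommutative.psi_spec {w : Perm (Fin (n + 1))} (hw : IsFullyCommutative w) :
    IsNC (psi w) ∧ (∀ m, m < psi w m ↔ m < w m) ∧ ∀ m, (psi w)⁻¹ m < m ↔ w⁻¹ m < m := by
  obtain ⟨l, hl⟩ := hw.avoids321.exists_isCanonicalForm
  have hJ : Fin.castSucc '' setJ w = {m | m < w m} := by
    ext m
    constructor
    · rintro ⟨j, ⟨l', hl', hj⟩, rfl⟩
      exact (hl'.image_snd j).1 hj
    · intro hm
      have hm' : m < w m := hm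
      have h1 := (w m).2
      rw [Fin.lt_def] at hm'
      exact ⟨⟨m, by omega⟩, ⟨l, hl, (hl.image_snd _).2 hm⟩, rfl⟩
  have hI : Fin.succ '' setI w = {m | w⁻¹ m < m} := by
    ext m
    constructor
    · rintro ⟨i, ⟨l', hl', hi⟩, rfl⟩
      exact (hl'.image_fst i).1 hi
    · intro hm
      have hm' : w⁻¹ m < m := hm
      obtain ⟨i, rfl⟩ := Fin.exists_succ_eq.2 (Fin.ne_zero_of_lt hm')
      exact ⟨i, ⟨l, hl, (hl.image_fst _).2 hm⟩, rfl⟩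
  have hex : ∃ x ∈ noncrossing n, setD x = Fin.castSucc '' setJ w ∧ setU x = Fin.succ '' setI w := by
    obtain ⟨x, h1, h2, h3⟩ := exists_isNC_excedances w
    refine ⟨x, h1.mem_noncrossing, ?_, ?_⟩
    · ext m
      rw [hJ, h1.mem_setD, h2]
      rfl
    · ext m
      rw [hI, h1.mem_setU, h3]
      rfl
  have hpsi : psi w = hex.choose := dif_pos hex
  obtain ⟨h1, h2, h3⟩ := hex.choose_spec
  rw [← hpsi, mem_noncrossing_iff] at h1
  rw [← hpsi] at h2 h3
  refine ⟨h1, fun m => ?_, fun m => ?_⟩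
  · rw [← h1.mem_setD, h2, hJ]
    rfl
  · rw [← h1.mem_setU, h3, hI]
    rfl

/- ### Twists of a noncrossing permutation by commuting simple transpositions -/

/-- No two indices are adjacent. -/
def IsSparse (S : Finset (Fin n)) : Prop :=
  ∀ i ∈ S, ∀ j ∈ S, (i : ℕ) + 1 ≠ j

/-- `k` is one of the two points moved by the simple transposition with index `i`. -/
def IsEnd (i : Fin n) (k : Fin (n + 1)) : Prop :=
  k = i.castSucc ∨ k = i.succ

theorem IsEnd.simpleRefl_self {i : Fin n} {k : Fin (n + 1)} (h : IsEnd i k) :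
    IsEnd i (simpleRefl i k) := by
  rcases h with rfl | rfl
  · exact Or.inr (simpleRefl_castSucc i)
  · exact Or.inl (simpleRefl_succ i)

theorem simpleRefl_of_not_isEnd {i : Fin n} {k : Fin (n + 1)} (h : ¬ IsEnd i k) :
    simpleRefl i k = k :=
  swap_apply_of_ne_of_ne (fun h' => h (Or.inl h')) fun h' => h (Or.inr h')

theorem isEnd_iff {i : Fin n} {k : Fin (n + 1)} :
    IsEnd i k ↔ (k : ℕ) = i ∨ (k : ℕ) = i + 1 := by
  simp [IsEnd, Fin.ext_iff]

theorem IsSparse.isEnd_simpleRefl {S : Finset (Fin n)} (hS : IsSparse S) {i j : Fin n}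
    (hi : i ∈ S) (hj : j ∈ S) {k : Fin (n + 1)} (h : IsEnd i k) : IsEnd i (simpleRefl j k) := by
  rcases eq_or_ne i j with rfl | hij
  · exact h.simpleRefl_self
  rw [simpleRefl_of_not_isEnd]
  · exact h
  have h1 := hS i hi j hj
  have h2 := hS j hj i hi
  have h3 := val_ne hij
  rw [isEnd_iff] at h ⊢
  omega

/-- Rewritten as a right multiplication, this either splits a cycle (`x i = i + 1`) or joins the
fixed point `i` to the cycle of its neighbour, across an empty arc. -/
theorem IsNC.simpleRefl_mul {x : Perm (Fin (n + 1))} (hx : IsNC x) {i : Fin n}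
    (h : IsEnd i (x i.castSucc)) : IsNC (simpleRefl i * x) := by
  rw [simpleRefl, swap_mul_eq_mul_swap]
  rcases h with h | h
  · have h1 : x⁻¹ i.castSucc = i.castSucc := Perm.inv_eq_iff_eq.2 h.symm
    have h2 : x (x⁻¹ i.succ) = i.succ := by simp
    have h3 : ∀ k : Fin (n + 1), ¬ CycIoo i.castSucc i.succ k := fun k => by
      unfold CycIoo
      rw [Fin.val_castSucc, Fin.val_succ]
      omega
    have h4 : (x⁻¹ i.succ : Fin (n + 1)) ≠ i.castSucc := by
      rw [← h1]
      exact x⁻¹.injective.ne i.castSucc_lt_succ.ne'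
    rw [h1]
    refine hx.merge ?_ (by rw [h2]; exact h3 _)
      fun k => by rw [h2]; exact iff_of_false (h3 _) (h3 _)
    have := val_ne h4
    rw [h]
    unfold CycIoo
    omega
  · rw [Perm.inv_eq_iff_eq.2 h.symm]
    exact hx.mul_swap ⟨1, by simp⟩

theorem IsNC.mul_simpleRefl {x : Perm (Fin (n + 1))} (hx : IsNC x) {j : Fin n}
    (h : x j.castSucc = j.succ ∨ x j.succ = j.succ) : IsNC (x * simpleRefl j) := by
  by_cases h1 : x j.castSucc = j.succ
  · exact hx.mul_swap ⟨1, by simpa using h1⟩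
  have h2 := h.resolve_left h1
  have h3 : ∀ k : Fin (n + 1), ¬ CycIoo j.castSucc j.succ k := fun k => by
    unfold CycIoo
    rw [Fin.val_castSucc, Fin.val_succ]
    omega
  refine hx.merge ?_ (by rw [h2]; exact h3 _)
      fun k => by rw [h2]; exact iff_of_false (h3 _) (h3 _)
  have := val_ne h1
  unfold CycIoo
  rw [Fin.val_succ] at *
  rw [Fin.val_castSucc]
  omega

/-- The conditions that make all twists of `x` by the simple transpositions in `L` and `R`
noncrossing. -/
structure IsTwistable (L R : Finset (Fin n)) (x : Perm (Fin (n + 1))) : Prop where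
  nc : IsNC x
  left : ∀ i ∈ L, IsEnd i (x i.castSucc)
  right : ∀ j ∈ R, x j.castSucc = j.succ ∨ x j.succ = j.succ
  -- The last two fields concern points shared by a left and a right letter. They make the
  -- conditions `left` and `right` survive multiplication on the other side.
  both : ∀ i ∈ L, i ∈ R → IsEnd i (x i.succ)
  adj : ∀ i ∈ L, ∀ j ∈ R, (j : ℕ) + 1 = i → IsEnd i (x j.castSucc)

theorem IsEnd.eq_or_eq {i : Fin n} {a b k : Fin (n + 1)} (ha : IsEnd i a) (hb : IsEnd i b)
    (hk : IsEnd i k) (hab : a ≠ b) : a = k ∨ b = k := by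
  unfold IsEnd at *
  grind

namespace IsTwistable

variable {L R : Finset (Fin n)} {x : Perm (Fin (n + 1))}

theorem simpleRefl_mul (h : IsTwistable L R x) (hL : IsSparse L) {i : Fin n} (hi : i ∈ L) :
    IsTwistable L R (simpleRefl i * x) where
  nc := h.nc.simpleRefl_mul (h.left i hi)
  left k hk := hL.isEnd_simpleRefl hk hi (h.left k hk)
  right j hj := by
    by_cases h1 : IsEnd i j.succ
    · rcases isEnd_iff.1 h1 with h2 | h2
      · rw [Fin.val_succ] at h2
        have h3 : i.castSucc = j.succ := Fin.ext (by simpa using h2.symm)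
        refine (hL.isEnd_simpleRefl hi hi (h.adj i hi j hj h2)).eq_or_eq ?_ h1
          ((simpleRefl i * x).injective.ne j.castSucc_lt_succ.ne)
        rw [← h3]
        exact hL.isEnd_simpleRefl hi hi (h.left i hi)
      · obtain rfl : j = i := Fin.ext (by simpa using h2)
        exact (hL.isEnd_simpleRefl hi hi (h.left j hi)).eq_or_eq
          (hL.isEnd_simpleRefl hi hi (h.both j hi hj)) h1
          ((simpleRefl j * x).injective.ne j.castSucc_lt_succ.ne)
    · have h2 := simpleRefl_of_not_isEnd h1
      rcases h.right j hj with h3 | h3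
      · exact Or.inl (by rw [Perm.mul_apply, h3, h2])
      · exact Or.inr (by rw [Perm.mul_apply, h3, h2])
  both k hk hk' := hL.isEnd_simpleRefl hk hi (h.both k hk hk')
  adj k hk j hj hjk := hL.isEnd_simpleRefl hk hi (h.adj k hk j hj hjk)

theorem mul_simpleRefl (h : IsTwistable L R x) (hR : IsSparse R) {j : Fin n} (hj : j ∈ R) :
    IsTwistable L R (x * simpleRefl j) where
  nc := h.nc.mul_simpleRefl (h.right j hj)
  left i hi := by
    rw [Perm.mul_apply]
    by_cases h1 : IsEnd j i.castSucc
    · rcases isEnd_iff.1 h1 with h2 | h2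
      · obtain rfl : i = j := Fin.ext (by simpa using h2)
        rw [simpleRefl_castSucc]
        exact h.both i hi hj
      · have h3 : i.castSucc = j.succ := Fin.ext (by simpa using h2)
        rw [h3, simpleRefl_succ]
        exact h.adj i hi j hj h2.symm
    · rw [simpleRefl_of_not_isEnd h1]
      exact h.left i hi
  right k hk := by
    rw [Perm.mul_apply, Perm.mul_apply]
    rcases eq_or_ne k j with rfl | hkj
    · rw [simpleRefl_castSucc, simpleRefl_succ]
      exact (h.right k hk).symm
    · have h1 := hR k hk j hj
      have h2 := hR j hj k hk
      have h3 := val_ne hkj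
      rw [simpleRefl_of_not_isEnd, simpleRefl_of_not_isEnd]
      · exact h.right k hk
      · rw [isEnd_iff, Fin.val_succ]
        omega
      · rw [isEnd_iff, Fin.val_castSucc]
        omega
  both i hi hi' := by
    rw [Perm.mul_apply]
    rcases hR.isEnd_simpleRefl hi' hj (Or.inr rfl : IsEnd i i.succ) with h1 | h1 <;> rw [h1]
    exacts [h.left i hi, h.both i hi hi']
  adj i hi k hk hki := by
    have h0 : k.succ = i.castSucc := Fin.ext (by simpa using hki)
    rw [Perm.mul_apply]
    rcases hR.isEnd_simpleRefl hk hj (Or.inl rfl : IsEnd k k.castSucc) with h1 | h1 <;> rw [h1]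
    · exact h.adj i hi k hk hki
    · rw [h0]
      exact h.left i hi

end IsTwistable

/- ### Descents and twists -/

section Descents

variable {w : Perm (Fin (n + 1))} (hw : IsFullyCommutative w)
include hw

theorem IsFullyCommutative.rightDescent {j : Fin n} (hj : j ∈ rightDescents w) :
    j.castSucc < psi w j.castSucc ∧ psi w j.succ ≤ j.succ := by
  obtain ⟨h1, h2⟩ := hw.avoids321.descent (mem_rightDescents.1 hj)
  exact ⟨(hw.psi_spec.2.1 _).2 h1, not_lt.1 fun h => h2.asymm ((hw.psi_spec.2.1 _).1 h)⟩

theorem IsFullyCommutative.leftDescent {i : Fin n} (hi : i ∈ leftDescents w) :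
    i.castSucc ≤ (psi w)⁻¹ i.castSucc ∧ (psi w)⁻¹ i.succ < i.succ := by
  rw [leftDescents_eq] at hi
  obtain ⟨h1, h2⟩ := hw.avoids321.inv.descent (mem_rightDescents.1 hi)
  exact ⟨not_lt.1 fun h => h1.asymm ((hw.psi_spec.2.2 _).1 h), (hw.psi_spec.2.2 _).2 h2⟩

theorem IsFullyCommutative.isSparse_rightDescents : IsSparse (rightDescents w) := by
  intro i hi j hj hij
  have h1 := (hw.avoids321.descent (mem_rightDescents.1 hi)).2
  have h2 := (hw.avoids321.descent (mem_rightDescents.1 hj)).1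
  rw [show j.castSucc = i.succ from Fin.ext (by simpa using hij.symm)] at h2
  exact h1.asymm h2

theorem IsFullyCommutative.isSparse_leftDescents : IsSparse (leftDescents w) := by
  intro i hi j hj hij
  rw [leftDescents_eq] at hi hj
  have h1 := (hw.avoids321.inv.descent (mem_rightDescents.1 hi)).2
  have h2 := (hw.avoids321.inv.descent (mem_rightDescents.1 hj)).1
  rw [show j.castSucc = i.succ from Fin.ext (by simpa using hij.symm)] at h2
  exact h1.asymm h2

/-- If `i` is not fixed, it is the image of some `p > i`. The interval from `i` to `p` is invariant
and contains `i + 1`, whose preimage is at most `i`, hence equal to `i`. -/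
theorem IsFullyCommutative.isEnd_psi {i : Fin n} (hi : i ∈ leftDescents w) :
    IsEnd i (psi w i.castSucc) := by
  obtain ⟨h1, h2⟩ := hw.leftDescent hi
  have hx := hw.psi_spec.1
  set x := psi w
  set p := x⁻¹ i.castSucc with hp
  have hxp : x p = i.castSucc := by simp [p]
  rcases h1.eq_or_lt with h | h
  · exact Or.inl (by rw [h, hxp, ← h])
  · have h3 : i.succ ≤ p := Fin.castSucc_lt_iff_succ_le.1 h
    have h4 := (hx.Icc_iff (m := p) (by rw [hxp]; exact h1) (x⁻¹ i.succ)).2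
      (by rw [hxp]; simpa using ⟨i.castSucc_lt_succ.le, h3⟩)
    rw [hxp] at h4
    have h5 : x⁻¹ i.succ = i.castSucc := le_antisymm (Fin.le_castSucc_iff.2 h2) h4.1
    exact Or.inr (Perm.inv_eq_iff_eq.1 h5).symm

theorem IsFullyCommutative.psi_eq_succ {j : Fin n} (hj : j ∈ rightDescents w) :
    psi w j.castSucc = j.succ ∨ psi w j.succ = j.succ := by
  obtain ⟨h1, h2⟩ := hw.rightDescent hj
  have hx := hw.psi_spec.1
  set x := psi w
  rcases h2.eq_or_lt with h | h
  · exact Or.inr h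
  · have h3 := (hx.Icc_iff h2 j.castSucc).1 ⟨Fin.le_castSucc_iff.2 h, j.castSucc_lt_succ.le⟩
    exact Or.inl (le_antisymm h3.2 (Fin.castSucc_lt_iff_succ_le.1 h1))

theorem IsFullyCommutative.psi_of_mem_both {i : Fin n} (hi : i ∈ leftDescents w)
    (hi' : i ∈ rightDescents w) : psi w i.castSucc = i.succ ∧ psi w i.succ = i.castSucc := by
  obtain ⟨h1, h2⟩ := hw.leftDescent hi
  obtain ⟨h3, h4⟩ := hw.rightDescent hi'
  have hx := hw.psi_spec.1
  have h5 : psi w i.castSucc = i.succ := (hw.isEnd_psi hi).resolve_left h3.ne'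
  refine ⟨h5, ?_⟩
  set x := psi w
  set p := x⁻¹ i.castSucc with hp
  have hxp : x p = i.castSucc := by simp [p]
  have hne : x i.succ ≠ i.succ := fun h => i.castSucc_lt_succ.ne (x.injective (h5.trans h.symm))
  have h6 : x i.succ < i.succ := lt_of_le_of_ne h4 hne
  have h7 := (hx.Icc_iff h4 p).2
    (by rw [hxp]; exact ⟨Fin.le_castSucc_iff.2 h6, i.castSucc_lt_succ.le⟩)
  have h8 : p ≠ i.castSucc := fun h => by
    rw [h] at hxp
    exact h3.ne' hxp
  have h9 : p = i.succ :=
    le_antisymm h7.2 (Fin.castSucc_lt_iff_succ_le.1 (lt_of_le_of_ne h1 h8.symm))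
  rw [← h9, hxp]

/-- The two descents leave `i` no choice but to be fixed. An arc ending at `i + 1` and starting
before `j` would trap the image of `j` at `i`, which is already taken. -/
theorem IsFullyCommutative.psi_of_adj {i j : Fin n} (hi : i ∈ leftDescents w)
    (hj : j ∈ rightDescents w) (hji : (j : ℕ) + 1 = i) :
    psi w i.castSucc = i.castSucc ∧ psi w j.castSucc = i.succ := by
  have h0 : j.succ = i.castSucc := Fin.ext (by simpa using hji)
  obtain ⟨h1, h2⟩ := hw.leftDescent hi
  obtain ⟨h3, h4⟩ := hw.rightDescent hj
  have hx := hw.psi_spec.1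
  have h5 : psi w i.castSucc = i.castSucc := by
    rcases hw.isEnd_psi hi with h | h
    · exact h
    · rw [h0, h] at h4
      exact absurd i.castSucc_lt_succ (not_lt.2 h4)
  refine ⟨h5, ?_⟩
  set x := psi w
  set q := x⁻¹ i.succ with hq
  have hxq : x q = i.succ := by simp [q]
  have hqi : q ≠ i.castSucc := fun h => by
    rw [h, h5] at hxq
    exact i.castSucc_lt_succ.ne hxq
  have hqj : q ≤ j.castSucc := by
    rw [Fin.le_castSucc_iff, h0]
    exact lt_of_le_of_ne (Fin.le_castSucc_iff.2 h2) hqi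
  rcases hqj.eq_or_lt with h | h
  · rw [← h, hxq]
  · exfalso
    have hji' : j.castSucc < i.succ := j.castSucc_lt_succ.trans (h0 ▸ i.castSucc_lt_succ)
    have h6 := (hx.Ioo_iff (m := q) (by rw [hxq]; exact h2) j.castSucc).1
      (by rw [hxq]; exact ⟨h, hji'⟩)
    rw [hxq] at h6
    have h7 : x j.castSucc ≤ i.castSucc := Fin.le_castSucc_iff.2 h6.2
    have h8 : i.castSucc ≤ x j.castSucc := h0 ▸ Fin.castSucc_lt_iff_succ_le.1 h3
    exact (j.castSucc_lt_succ.trans_eq h0).ne (x.injective ((le_antisymm h7 h8).trans h5.symm))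

theorem IsFullyCommutative.isTwistable :
    IsTwistable (leftDescents w) (rightDescents w) (psi w) where
  nc := hw.psi_spec.1
  left _ hi := hw.isEnd_psi hi
  right _ hj := hw.psi_eq_succ hj
  both _ hi hi' := Or.inl (hw.psi_of_mem_both hi hi').2
  adj _ hi _ hj hji := Or.inr (hw.psi_of_adj hi hj hji).2

/-- In each kind of conflict, `ψ(w)` carries the two points moved by `s_j` to those moved by `s_i`,
so it conjugates one letter into the other. -/
theorem IsFullyCommutative.simpleRefl_mul_psi {i j : Fin n} (hi : i ∈ leftDescents w)
    (hj : j ∈ rightDescents w) (hij : i = j ∨ (j : ℕ) + 1 = i) :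
    simpleRefl i * psi w * simpleRefl j = psi w := by
  have key : psi w * simpleRefl j = simpleRefl i * psi w := by
    rw [simpleRefl, mul_swap_eq_swap_mul]
    rcases hij with rfl | hij
    · obtain ⟨h1, h2⟩ := hw.psi_of_mem_both hi hj
      rw [h1, h2, swap_comm, simpleRefl]
    · obtain ⟨h1, h2⟩ := hw.psi_of_adj hi hj hij
      rw [show j.succ = i.castSucc from Fin.ext (by simpa using hij), h1, h2, swap_comm, simpleRefl]
  rw [mul_assoc, key, simpleRefl_mul_cancel_left]

end Descents

/- ### Products over sparse sets -/

theorem commute_simpleRefl {i j : Fin n} (h1 : (i : ℕ) + 1 ≠ j) (h2 : (j : ℕ) + 1 ≠ i) :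
    Commute (simpleRefl i) (simpleRefl j) := by
  rcases eq_or_ne i j with rfl | hij
  · exact Commute.refl _
  have h3 := val_ne hij
  have h4 : ¬ IsEnd i j.castSucc := by rw [isEnd_iff, Fin.val_castSucc]; omega
  have h5 : ¬ IsEnd i j.succ := by rw [isEnd_iff, Fin.val_succ]; omega
  change simpleRefl i * swap _ _ = swap _ _ * simpleRefl i
  rw [mul_swap_eq_swap_mul, simpleRefl_of_not_isEnd h4, simpleRefl_of_not_isEnd h5]

theorem IsSparse.mono {S T : Finset (Fin n)} (hT : IsSparse T) (h : S ⊆ T) : IsSparse S :=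
  fun i hi j hj => hT i (h hi) j (h hj)

theorem IsSparse.commute {S : Finset (Fin n)} (hS : IsSparse S) {i j : Fin n} (hi : i ∈ S)
    (hj : j ∈ S) : Commute (simpleRefl i) (simpleRefl j) :=
  commute_simpleRefl (hS i hi j hj) (hS j hj i hi)

theorem setProd_insert {S : Finset (Fin n)} {i : Fin n} (hi : i ∉ S)
    (hS : IsSparse (insert i S)) : setProd (insert i S) = simpleRefl i * setProd S := by
  have hperm : ((insert i S).sort (· ≤ ·)).Perm (i :: S.sort (· ≤ ·)) := by
    rw [List.perm_ext_iff_of_nodup (Finset.sort_nodup _ _)]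
    · intro k
      simp
    · rw [List.nodup_cons]
      exact ⟨by simpa using hi, Finset.sort_nodup _ _⟩
  rw [setProd, setProd, ← wordProd_cons, wordProd, wordProd]
  refine (hperm.map simpleRefl).prod_eq' (List.pairwise_map.2 (List.Pairwise.imp_of_mem
    (R := fun _ _ => True) (fun ha hb _ => ?_) (List.pairwise_of_forall fun _ _ => trivial)))
  exact hS.commute (by simpa using ha) (by simpa using hb)

theorem IsSparse.commute_setProd {S T : Finset (Fin n)} (hT : IsSparse T) {i : Fin n}
    (hi : i ∈ T) (hS : S ⊆ T) : Commute (simpleRefl i) (setProd S) := by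
  induction S using Finset.induction_on with
  | empty => simp [setProd, wordProd]
  | insert j S hj ih =>
    rw [setProd_insert hj (hT.mono hS)]
    exact (hT.commute hi (hS (Finset.mem_insert_self _ _))).mul_right
      (ih ((Finset.subset_insert _ _).trans hS))

theorem IsSparse.exists_setProd_eq {S T : Finset (Fin n)} (hT : IsSparse T) {i : Fin n}
    (hi : i ∈ T) (hS : S ⊆ T) : ∃ S' ⊆ T, simpleRefl i * setProd S = setProd S' := by
  by_cases h : i ∈ S
  · refine ⟨S.erase i, (Finset.erase_subset _ _).trans hS, ?_⟩
    conv_lhs => rw [← Finset.insert_erase h]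
    rw [setProd_insert (Finset.notMem_erase _ _), simpleRefl_mul_cancel_left]
    rw [Finset.insert_erase h]
    exact hT.mono hS
  · exact ⟨insert i S, Finset.insert_subset hi hS,
      (setProd_insert h (hT.mono (Finset.insert_subset hi hS))).symm⟩

theorem IsTwistable.setProd_mul {L R : Finset (Fin n)} {x : Perm (Fin (n + 1))}
    (h : IsTwistable L R x) (hL : IsSparse L) {A : Finset (Fin n)} (hA : A ⊆ L) :
    IsTwistable L R (setProd A * x) := by
  induction A using Finset.induction_on with
  | empty => simpa [setProd, wordProd] using h
  | insert i A hi ih =>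
    rw [setProd_insert hi (hL.mono hA), mul_assoc]
    exact (ih ((Finset.subset_insert _ _).trans hA)).simpleRefl_mul hL
      (hA (Finset.mem_insert_self _ _))

theorem IsTwistable.mul_setProd {L R : Finset (Fin n)} {x : Perm (Fin (n + 1))}
    (h : IsTwistable L R x) (hR : IsSparse R) {B : Finset (Fin n)} (hB : B ⊆ R) :
    IsTwistable L R (x * setProd B) := by
  induction B using Finset.induction_on with
  | empty => simpa [setProd, wordProd] using h
  | insert i B hi ih =>
    have hB' := (Finset.subset_insert _ _).trans hB
    have hi' := hB (Finset.mem_insert_self _ _)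
    rw [setProd_insert hi (hR.mono hB), (hR.commute_setProd hi' hB').eq, ← mul_assoc]
    exact (ih hB').mul_simpleRefl hR hi'

/- ### The set `Q_w` -/

theorem PairStep.le {p q : Finset (Fin n) × Finset (Fin n)} (h : PairStep p q) :
    q.1 ⊆ p.1 ∧ q.2 ⊆ p.2 := by
  cases h with
  | bothLeft _ _ _ _ _ => exact ⟨Finset.erase_subset _ _, subset_rfl⟩
  | bothRight _ _ _ _ _ => exact ⟨subset_rfl, Finset.erase_subset _ _⟩
  | adjLeft _ _ _ _ _ _ _ => exact ⟨Finset.erase_subset _ _, subset_rfl⟩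
  | adjRight _ _ _ _ _ _ _ => exact ⟨subset_rfl, Finset.erase_subset _ _⟩

theorem IsEndingPair.le {p q : Finset (Fin n) × Finset (Fin n)} (h : IsEndingPair p q) :
    q.1 ⊆ p.1 ∧ q.2 ⊆ p.2 := by
  obtain ⟨h, -⟩ := h
  induction h with
  | refl => exact ⟨subset_rfl, subset_rfl⟩
  | tail _ h ih => exact ⟨h.le.1.trans ih.1, h.le.2.trans ih.2⟩

theorem PairStep.exists_conflict {A B : Finset (Fin n)} {p : Finset (Fin n) × Finset (Fin n)}
    (h : PairStep (A, B) p) : ∃ i ∈ A, ∃ j ∈ B, i = j ∨ (j : ℕ) + 1 = i := by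
  cases h with
  | bothLeft _ _ i hL hR => exact ⟨i, hL, i, hR, Or.inl rfl⟩
  | bothRight _ _ i hL hR => exact ⟨i, hL, i, hR, Or.inl rfl⟩
  | adjLeft _ _ j k h hL hR => exact ⟨j, hL, k, hR, Or.inr h⟩
  | adjRight _ _ j k h hL hR => exact ⟨j, hL, k, hR, Or.inr h⟩

section SetQ

variable {w : Perm (Fin (n + 1))} (hw : IsFullyCommutative w)
include hw

/-- A pair of sets with a conflict gives the same permutation as the pair with both conflicting
letters removed. Repeating this reaches a pair without conflicts, which is its own ending pair. -/
theorem IsFullyCommutative.mem_setQ {x : Perm (Fin (n + 1))} :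
    x ∈ setQ w ↔ ∃ A ⊆ leftDescents w, ∃ B ⊆ rightDescents w,
      x = setProd A * psi w * setProd B := by
  constructor
  · rintro ⟨L, hL, R, hR, A, B, h, rfl⟩
    exact ⟨A, h.le.1.trans hL, B, h.le.2.trans hR, rfl⟩
  · rintro ⟨A, hA, B, hB, rfl⟩
    have key : ∀ (c : ℕ), ∀ A ⊆ leftDescents w, ∀ B ⊆ rightDescents w, A.card = c →
        setProd A * psi w * setProd B ∈ setQ w := by
      intro c
      induction c using Nat.strong_induction_on with
      | _ c ih =>
        intro A hA B hB hc
        by_cases h : ∃ p, PairStep (A, B) p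
        · obtain ⟨p, hp⟩ := h
          obtain ⟨i, hi, j, hj, hij⟩ := hp.exists_conflict
          have h1 := (Finset.erase_subset i A).trans hA
          have h2 := (Finset.erase_subset j B).trans hB
          have h3 : setProd A = setProd (A.erase i) * simpleRefl i := by
            conv_lhs => rw [← Finset.insert_erase hi]
            rw [setProd_insert (Finset.notMem_erase _ _)
              (hw.isSparse_leftDescents.mono (by rwa [Finset.insert_erase hi])),
              (hw.isSparse_leftDescents.commute_setProd (hA hi) h1).eq]
          have h4 : setProd B = simpleRefl j * setProd (B.erase j) := by
            conv_lhs => rw [← Finset.insert_erase hj]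
            exact setProd_insert (Finset.notMem_erase _ _)
              (hw.isSparse_rightDescents.mono (by rwa [Finset.insert_erase hj]))
          have h5 : setProd A * psi w * setProd B =
              setProd (A.erase i) * psi w * setProd (B.erase j) := by
            rw [h3, h4]
            conv_rhs => rw [← hw.simpleRefl_mul_psi (hA hi) (hB hj) hij]
            simp only [mul_assoc]
          rw [h5]
          exact ih _ (by rw [← hc]; exact Finset.card_erase_lt_of_mem hi) _ h1 _ h2 rfl
        · exact ⟨A, hA, B, hB, A, B, ⟨Relation.ReflTransGen.refl, not_exists.1 h⟩, rfl⟩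
    exact key _ A hA B hB rfl

theorem IsFullyCommutative.isNC_of_mem_setQ {x : Perm (Fin (n + 1))} (hx : x ∈ setQ w) :
    IsNC x := by
  obtain ⟨A, hA, B, hB, rfl⟩ := hw.mem_setQ.1 hx
  exact ((hw.isTwistable.setProd_mul hw.isSparse_leftDescents hA).mul_setProd
    hw.isSparse_rightDescents hB).nc

theorem IsFullyCommutative.simpleRefl_mul_mem_setQ {x : Perm (Fin (n + 1))} (hx : x ∈ setQ w)
    {i : Fin n} (hi : i ∈ leftDescents w) : simpleRefl i * x ∈ setQ w := by
  obtain ⟨A, hA, B, hB, rfl⟩ := hw.mem_setQ.1 hx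
  obtain ⟨A', hA', h⟩ := hw.isSparse_leftDescents.exists_setProd_eq hi hA
  exact hw.mem_setQ.2 ⟨A', hA', B, hB, by rw [← h]; simp only [mul_assoc]⟩

theorem IsFullyCommutative.mul_simpleRefl_mem_setQ {x : Perm (Fin (n + 1))} (hx : x ∈ setQ w)
    {i : Fin n} (hi : i ∈ rightDescents w) : x * simpleRefl i ∈ setQ w := by
  obtain ⟨A, hA, B, hB, rfl⟩ := hw.mem_setQ.1 hx
  obtain ⟨B', hB', h⟩ := hw.isSparse_rightDescents.exists_setProd_eq hi hB
  exact hw.mem_setQ.2 ⟨A, hA, B', hB', by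
    rw [← h, (hw.isSparse_rightDescents.commute_setProd hi hB).eq, mul_assoc]⟩

end SetQ

/- ### The action of the generators on `X_w` -/

/-- The Coxeter length enters the coefficient only through its parity, that is, through the sign of
the permutation. -/
theorem coeffP_eq_neg (w : Perm (Fin (n + 1))) {x y : Perm (Fin (n + 1))}
    (hsign : Perm.sign y = -Perm.sign x) (hlen : lenT y = lenT x + 1) :
    coeffP w y = -(vPow 1 * coeffP w x) := by
  have key : ∀ z : Perm (Fin (n + 1)), (-1 : ℤˣ) ^ alphaExp w z =
      (-1) ^ ((lenS w : ℤ) + lenS (psi w)) * Perm.sign z := fun z => by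
    rw [alphaExp, zpow_sub, zpow_natCast, ← sign_eq_lenS, Int.units_inv_eq_self]
  have h1 : betaExp w y = 1 + betaExp w x := by
    simp only [betaExp, hlen]
    push_cast
    ring
  rw [coeffP, coeffP, key, key, hsign, h1, vPow, LaurentPolynomial.T_add, mul_neg, Units.val_neg, neg_smul,
    mul_smul_comm]

/-- Each orbit of the involution is represented by its member with the smaller value of `h`, which
will be the transposition length. -/
theorem sum_eq_sum_pairs {α M : Type*} [AddCommMonoid M] (Q : Finset α) (f : α → M) (σ : α → α)
    (hσ : ∀ x ∈ Q, σ x ∈ Q) (hσσ : ∀ x, σ (σ x) = x) (h : α → ℕ) (hne : ∀ x, h (σ x) ≠ h x) :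
    ∑ x ∈ Q, f x = ∑ x ∈ Q.filter (fun x => h x < h (σ x)), (f x + f (σ x)) := by
  rw [← Finset.sum_filter_add_sum_filter_not Q (fun x => h x < h (σ x)), Finset.sum_add_distrib]
  congr 1
  refine Finset.sum_nbij' σ σ ?_ ?_ (fun x _ => hσσ x) (fun x _ => hσσ x) (fun x _ => by rw [hσσ])
  · intro x hx
    rw [Finset.mem_filter] at hx ⊢
    rw [hσσ]
    exact ⟨hσ x hx.1, lt_of_le_of_ne (not_lt.1 hx.2) (hne x)⟩
  · intro x hx
    rw [Finset.mem_filter] at hx ⊢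
    rw [hσσ]
    exact ⟨hσ x hx.1, hx.2.asymm⟩

theorem lenT_simpleRefl_mul (i : Fin n) (x : Perm (Fin (n + 1))) :
    lenT (simpleRefl i * x) = lenT x + 1 ∨ lenT (simpleRefl i * x) + 1 = lenT x := by
  rw [simpleRefl, swap_mul_eq_mul_swap]
  exact lenT_mul_swap ⟨_, _, x⁻¹.injective.ne i.castSucc_lt_succ.ne, rfl⟩

/-- The terms free of `b` cancel within a pair, which leaves a multiple of `b`. -/
theorem smul_add_smul_left {A : Type*} [Ring A] [Algebra Scalars A] (c : Scalars) (b z : A) :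
    c • z + (-(vPow 1 * c)) • ((vPow (-1) • (1 : A) - b) * z) = (vPow 1 * c) • (b * z) := by
  have h := vPow_mul_neg
  have h1 : vPow 1 * c * vPow (-1) = c := by rw [mul_right_comm, h, one_mul]
  rw [sub_mul, smul_sub, smul_mul_assoc, one_mul, smul_smul, neg_mul, h1, neg_smul, neg_smul]
  abel

theorem smul_add_smul_right {A : Type*} [Ring A] [Algebra Scalars A] (c : Scalars) (b z : A) :
    c • z + (-(vPow 1 * c)) • (z * (vPow (-1) • (1 : A) - b)) = (vPow 1 * c) • (z * b) := by
  have h := vPow_mul_neg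
  have h1 : vPow 1 * c * vPow (-1) = c := by rw [mul_right_comm, h, one_mul]
  rw [mul_sub, smul_sub, mul_smul_comm, mul_one, smul_smul, neg_mul, h1, neg_smul, neg_smul]
  abel

theorem tlGen_mul_basisX {w : Perm (Fin (n + 1))} (hw : IsFullyCommutative w) {i : Fin n}
    (hi : i ∈ leftDescents w) :
    tlGen i * basisX w = (vPow 1 + vPow (-1)) • basisX w := by
  classical
  have hsum := sum_eq_sum_pairs (Finset.univ.filter (fun x => x ∈ setQ w))
    (fun x => coeffP w x • zinno x) (fun x => simpleRefl i * x)
    (fun x hx => by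
      rw [Finset.mem_filter] at hx ⊢
      exact ⟨Finset.mem_univ _, hw.simpleRefl_mul_mem_setQ hx.2 hi⟩)
    (simpleRefl_mul_cancel_left i) lenT
    (fun x => by rcases lenT_simpleRefl_mul i x with h | h <;> omega)
  have hX : basisX w = ∑ x ∈ Finset.univ.filter (fun x => x ∈ setQ w), coeffP w x • zinno x := by
    rw [basisX]
  rw [hX, hsum, Finset.mul_sum, Finset.smul_sum]
  refine Finset.sum_congr rfl fun x hx => ?_
  rw [Finset.mem_filter, Finset.mem_filter] at hx
  have hlen : lenT (simpleRefl i * x) = lenT x + 1 := by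
    rcases lenT_simpleRefl_mul i x with h | h <;> omega
  have hnc := hw.isNC_of_mem_setQ (hw.simpleRefl_mul_mem_setQ hx.1.2 hi)
  rw [coeffP_eq_neg w (by rw [map_mul, sign_simpleRefl, neg_one_mul]) hlen,
    zinno_simpleRefl_mul hnc hlen, smul_add_smul_left, mul_smul_comm, ← mul_assoc, tlGen_sq,
    smul_mul_assoc, smul_comm]

theorem basisX_mul_tlGen {w : Perm (Fin (n + 1))} (hw : IsFullyCommutative w) {i : Fin n}
    (hi : i ∈ rightDescents w) :
    basisX w * tlGen i = (vPow 1 + vPow (-1)) • basisX w := by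
  classical
  have hcancel : ∀ x : Perm (Fin (n + 1)), x * simpleRefl i * simpleRefl i = x := fun x => by
    rw [mul_assoc, simpleRefl_mul_self, mul_one]
  have hsum := sum_eq_sum_pairs (Finset.univ.filter (fun x => x ∈ setQ w))
    (fun x => coeffP w x • zinno x) (fun x => x * simpleRefl i)
    (fun x hx => by
      rw [Finset.mem_filter] at hx ⊢
      exact ⟨Finset.mem_univ _, hw.mul_simpleRefl_mem_setQ hx.2 hi⟩)
    hcancel lenT (fun x => lenT_mul_ne (isSwap_simpleRefl i))
  have hX : basisX w = ∑ x ∈ Finset.univ.filter (fun x => x ∈ setQ w), coeffP w x • zinno x := by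
    rw [basisX]
  rw [hX, hsum, Finset.sum_mul, Finset.smul_sum]
  refine Finset.sum_congr rfl fun x hx => ?_
  rw [Finset.mem_filter, Finset.mem_filter] at hx
  have hlen : lenT (x * simpleRefl i) = lenT x + 1 := by
    rcases lenT_mul_swap (x := x) (isSwap_simpleRefl i) with h | h <;> omega
  have hnc := hw.isNC_of_mem_setQ (hw.mul_simpleRefl_mem_setQ hx.1.2 hi)
  rw [coeffP_eq_neg w (by rw [map_mul, sign_simpleRefl, mul_neg_one]) hlen,
    zinno_mul_simpleRefl hnc hlen, smul_add_smul_right, smul_mul_assoc, mul_assoc, tlGen_sq,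
    mul_smul_comm, smul_comm]

end ZinnoTL

theorem mainTheorem8 (n : ℕ) (w : Equiv.Perm (Fin (n + 1)))
    (hw : ZinnoTL.IsFullyCommutative w) :
    (∀ i ∈ ZinnoTL.leftDescents w,
      ZinnoTL.tlGen i * ZinnoTL.basisX w =
        (ZinnoTL.vPow 1 + ZinnoTL.vPow (-1)) • ZinnoTL.basisX w) ∧
    (∀ i ∈ ZinnoTL.rightDescents w,
      ZinnoTL.basisX w * ZinnoTL.tlGen i =
        (ZinnoTL.vPow 1 + ZinnoTL.vPow (-1)) • ZinnoTL.basisX w) :=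
  ⟨fun _ hi => ZinnoTL.tlGen_mul_basisX hw hi, fun _ hi => ZinnoTL.basisX_mul_tlGen hw hi⟩
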